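/- Let $d\ge 1$, $\delta>1$, $J>0$ and $\lambda\ge 0$. Let $\mathbb{H}_+=\mathbb{Z}^{d-1}\times\{1,2,\dots\}$, $\Lambda_n=[-n,n]^{d-1}\times[1,n]$, $\mathcal{W}_n=[-n,n]^{d-1}\times\{1\}$, and let $\Delta_n$ be the union of $\Lambda_n$ and its reflection in the hyperplane $\{i_d=\tfrac12\}$. For $h\ge 0$ let $\widehat{\boldsymbol{h}}=(h\, i_d^{-\delta})_{i\in\mathbb{H}_+}$. For the Ising model on $\mathbb{H}_+$ let $\mathcal{Z}^{\pm}_{n;\widehat{\boldsymbol{h}}}$ and $\langle\cdot\rangle^{\pm}_{n;J,\widehat{\boldsymbol{h}}}$ be the partition function and the Gibbs expectation, with weights $e^{-\mathcal H}$, in $\Lambda_n$ with boundary condition $\sigma\equiv\pm1$ on $\mathbb{H}_+\setminus\Lambda_n$ and Hamiltonian $$\mathcal{H}(\sigma)=-\sum_{\substack{\{i,j\}\subset\mathbb{H}_+,\ |i-j|=1\\ \{i,j\}\cap\Lambda_n\ne\emptyset}}J\sigma_i\sigma_j-\sum_{i\in\Lambda_n}\frac{h}{i_d^{\delta}}\,\sigma_i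 ,$$ and let $\langle\cdot\rangle^{\pm}_{J,\widehat{\boldsymbol{h}}}=\lim_{n\to\infty}\langle\cdot\rangle^{\pm}_{n;J,\widehat{\boldsymbol{h}}}$. Let $Q^{\pm}_{\Delta_n;J}$ be the partition function of the nearest-neighbour Ising model on $\mathbb{Z}^d$ in $\Delta_n$ with coupling $J$, zero external field and $\pm$ boundary condition. Put $$\tilde F^{\pm}(J,\widehat{\boldsymbol{\lambda}})=\lim_{n\to\infty}-\frac{1}{2|\mathcal{W}_n|}\ln\frac{\bigl(\mathcal{Z}^{\pm}_{n;\widehat{\boldsymbol{\lambda}}}\bigr)^2}{Q^{\pm}_{\Delta_n;J}},\qquad \tilde\tau_w(J,\widehat{\boldsymbol{\lambda}})=\tilde F^{-}(J,\widehat{\boldsymbol{\lambda}})-\tilde F^{+}(J,\widehat{\boldsymbol{\lambda}}).$$ Then the limits $\tilde F^{\pm}(J,\widehat{\boldsymbol{\lambda}})$ exist; for all $s\ge0$ and $\ell\ge1$ the limits $\langle\sigma_{\ell e_d}\rangle^{\pm}_{J,\widehat{\boldsymbol{s}}}$ exist, where $e_d=(0,\dots,0,1)$; for every $s\ge 0$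 the series below converges absolutely; its sum is an integrable function of $s\in[0,\lambda]$; and $$\tilde\tau_w(J,\widehat{\boldsymbol{\lambda}})=\int_0^\lambda\sum_{\ell=1}^{\infty}\frac{1}{\ell^{\delta}}\Bigl(\langle\sigma_{\ell e_d}\rangle^{+}_{J,\widehat{\boldsymbol{s}}}-\langle\sigma_{\ell e_d}\rangle^{-}_{J,\widehat{\boldsymbol{s}}}\Bigr)\,ds .$$ -/

import Mathlib

open Filter Topology MeasureTheory

namespace SemiInfiniteIsing

noncomputable section

/-! ### The nearest-neighbour Ising model in a finite volume of a locally finite graph -/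

section FiniteVolume

/-- The real value `+1` or `-1` of a spin; the spin space `{-1, 1}` is the unit group of `ℤ`. -/
def spin (u : ℤˣ) : ℝ := ((u : ℤ) : ℝ)

/-- The configuration that equals `τ` in `Λ` and the boundary condition `η` outside `Λ`. -/
def glue {V : Type*} [DecidableEq V] (Λ : Finset V) (η : V → ℤˣ) (τ : Λ → ℤˣ) : V → ℤˣ :=
  fun i => if hi : i ∈ Λ then τ ⟨i, hi⟩ else η i

/-- The edges of `G` with at least one endpoint in `Λ`. -/
def touchingEdges {V : Type*} [DecidableEq V] (G : SimpleGraph V) [G.LocallyFinite]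
    (Λ : Finset V) : Finset (Sym2 V) :=
  Λ.biUnion fun i => G.incidenceFinset i

/-- The Hamiltonian
`-∑_{i ~ j, {i,j} ∩ Λ ≠ ∅} J σ_i σ_j - ∑_{i ∈ Λ} h_i σ_i`
(each unordered pair counted once). -/
def hamiltonian {V : Type*} [DecidableEq V] (G : SimpleGraph V) [G.LocallyFinite]
    (J : ℝ) (h : V → ℝ) (Λ : Finset V) (σ : V → ℤˣ) : ℝ :=
  -(∑ e ∈ touchingEdges G Λ, J * (e.map fun i => spin (σ i)).mul) - ∑ i ∈ Λ, h i * spin (σ i)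

/-- The partition function in `Λ` with boundary condition `η`. -/
def partitionFunction {V : Type*} [DecidableEq V] (G : SimpleGraph V) [G.LocallyFinite]
    (J : ℝ) (h : V → ℝ) (Λ : Finset V) (η : V → ℤˣ) : ℝ :=
  ∑ τ : Λ → ℤˣ, Real.exp (-hamiltonian G J h Λ (glue Λ η τ))

/-- The expectation of `f` under the Gibbs measure in `Λ` with boundary condition `η`. -/
def gibbsExpectation {V : Type*} [DecidableEq V] (G : SimpleGraph V) [G.LocallyFinite]
    (J : ℝ) (h : V → ℝ) (Λ : Finset V) (η : V → ℤˣ) (f : (V → ℤˣ) → ℝ) : ℝ :=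
  (∑ τ : Λ → ℤˣ, f (glue Λ η τ) * Real.exp (-hamiltonian G J h Λ (glue Λ η τ))) /
    partitionFunction G J h Λ η

end FiniteVolume

/-! ### The lattice `ℤ^d` and the half-space `ℤ^(d-1) × {1, 2, …}` -/

/-- `ℤ^d = ℤ^(d-1) × ℤ`; the second component is the last coordinate `i_d`. -/
abbrev Site (d : ℕ) : Type := (Fin (d - 1) → ℤ) × ℤ

/-- The nearest-neighbour graph of `ℤ^d`. -/
def lattice (d : ℕ) : SimpleGraph (Site d) where
  Adj i j := (∑ k, |i.1 k - j.1 k|) + |i.2 - j.2| = 1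
  symm := ⟨fun i j hij => by
    simpa only [abs_sub_comm] using hij⟩
  loopless := ⟨fun i hi => by simp at hi⟩

/-- The half-space `ℤ^(d-1) × {1, 2, …}`. -/
def halfSpace (d : ℕ) : Set (Site d) := {i | 1 ≤ i.2}

/-- The nearest-neighbour graph of the half-space: only the bonds of `ℤ^d` with both endpoints in
the half-space are kept, so the sites outside the half-space are isolated and play no role for
volumes contained in the half-space. -/
def halfLattice (d : ℕ) : SimpleGraph (Site d) where
  Adj i j := i ∈ halfSpace d ∧ j ∈ halfSpace d ∧ (lattice d).Adj i j
  symm := ⟨fun _ _ h => ⟨h.2.1, h.1, h.2.2.symm⟩⟩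
  loopless := ⟨fun _ h => (lattice d).loopless.irrefl _ h.2.2⟩

theorem lattice_neighborSet_finite (d : ℕ) (i : Site d) :
    ((lattice d).neighborSet i).Finite := by
  refine ((Set.finite_Icc (i.1 - 1) (i.1 + 1)).prod
    (Set.finite_Icc (i.2 - 1) (i.2 + 1))).subset fun j hj => ?_
  have hj' : (∑ k, |i.1 k - j.1 k|) + |i.2 - j.2| = 1 := hj
  have h0 : 0 ≤ ∑ k, |i.1 k - j.1 k| := Finset.sum_nonneg fun k _ => abs_nonneg _
  have h1 : ∀ k, |i.1 k - j.1 k| ≤ 1 := fun k => by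
    have : |i.1 k - j.1 k| ≤ ∑ k, |i.1 k - j.1 k| :=
      Finset.single_le_sum (f := fun k => |i.1 k - j.1 k|)
        (fun k _ => abs_nonneg _) (Finset.mem_univ k)
    have h2 := abs_nonneg (i.2 - j.2)
    linarith
  have h2 : |i.2 - j.2| ≤ 1 := by linarith
  rw [abs_le] at h2
  refine ⟨⟨fun k => ?_, fun k => ?_⟩, ⟨by linarith, by linarith⟩⟩
  · have := abs_le.1 (h1 k)
    show i.1 k - 1 ≤ j.1 k
    linarith
  · have := abs_le.1 (h1 k)
    show j.1 k ≤ i.1 k + 1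
    linarith

instance instLocallyFiniteLattice (d : ℕ) : (lattice d).LocallyFinite :=
  fun i => (lattice_neighborSet_finite d i).fintype

instance instLocallyFiniteHalfLattice (d : ℕ) : (halfLattice d).LocallyFinite :=
  fun i => ((lattice_neighborSet_finite d i).subset fun _ hj => hj.2.2).fintype

/-- The box `Λ_n = [-n, n]^(d-1) × [1, n]`. -/
def box (d n : ℕ) : Finset (Site d) :=
  Finset.Icc (fun _ => -(n : ℤ)) (fun _ => (n : ℤ)) ×ˢ Finset.Icc 1 (n : ℤ)

/-- The wall `W_n = [-n, n]^(d-1) × {1}`. -/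
def wall (d n : ℕ) : Finset (Site d) :=
  Finset.Icc (fun _ => -(n : ℤ)) (fun _ => (n : ℤ)) ×ˢ {1}

/-- The reflection of `ℤ^d` in the hyperplane `i_d = 1/2`. -/
def reflect {d : ℕ} (i : Site d) : Site d := (i.1, 1 - i.2)

/-- `Δ_n`: the union of `Λ_n` and its reflection. -/
def doubleBox (d n : ℕ) : Finset (Site d) := box d n ∪ (box d n).image reflect

/-- The site `ℓ e_d`. -/
def axisSite (d ℓ : ℕ) : Site d := (0, (ℓ : ℤ))

/-- The external field `h / i_d ^ δ`. Only its values in the half-space are ever used. -/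
def decayingField (d : ℕ) (δ h : ℝ) : Site d → ℝ := fun i => h / (i.2 : ℝ) ^ δ

/-! ### The semi-infinite model -/

/-- The constant boundary condition: `ε = 1` is `+`, `ε = -1` is `-`. -/
def constBC (d : ℕ) (ε : ℤˣ) : Site d → ℤˣ := fun _ => ε

/-- The partition function of the semi-infinite model in `Λ_n`, with constant boundary
condition `ε`. -/
def boxPartition (d : ℕ) (J : ℝ) (h : Site d → ℝ) (ε : ℤˣ) (n : ℕ) : ℝ :=
  partitionFunction (halfLattice d) J h (box d n) (constBC d ε)

/-- The partition function of the Ising model of `ℤ^d` in `Δ_n`, with zero field and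
constant boundary condition `ε`. -/
def doubleBoxPartition (d : ℕ) (J : ℝ) (ε : ℤˣ) (n : ℕ) : ℝ :=
  partitionFunction (lattice d) J 0 (doubleBox d n) (constBC d ε)

/-- The finite-volume expectation of `f` in the semi-infinite model in `Λ_n`. -/
def boxState (d : ℕ) (J : ℝ) (h : Site d → ℝ) (ε : ℤˣ) (n : ℕ) (f : (Site d → ℤˣ) → ℝ) : ℝ :=
  gibbsExpectation (halfLattice d) J h (box d n) (constBC d ε) f

/-- The infinite-volume state `⟨f⟩^±_{J,h}` of the semi-infinite model: the limit of the states
in `Λ_n` with `±` boundary condition. -/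
def limitState (d : ℕ) (J : ℝ) (h : Site d → ℝ) (ε : ℤˣ) (f : (Site d → ℤˣ) → ℝ) : ℝ :=
  limUnder atTop fun n => boxState d J h ε n f

/-- `-(1 / (2 |W_n|)) ln ((Z_n^±)² / Q_{Δ_n}^±)`. -/
def surfaceEnergySeq (d : ℕ) (J : ℝ) (h : Site d → ℝ) (ε : ℤˣ) (n : ℕ) : ℝ :=
  -(1 / (2 * ((wall d n).card : ℝ))) *
    Real.log (boxPartition d J h ε n ^ 2 / doubleBoxPartition d J ε n)

/-- The free surface energy with `±` boundary condition. -/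
def surfaceEnergy (d : ℕ) (J : ℝ) (h : Site d → ℝ) (ε : ℤˣ) : ℝ :=
  limUnder atTop (surfaceEnergySeq d J h ε)

/-- The (modified) wall free energy. -/
def wallFreeEnergy (d : ℕ) (J : ℝ) (h : Site d → ℝ) : ℝ :=
  surfaceEnergy d J h (-1) - surfaceEnergy d J h 1

/-- The observable `σ_i`. -/
def spinAt {d : ℕ} (i : Site d) : (Site d → ℤˣ) → ℝ := fun σ => spin (σ i)

/-- `ℓ^{-δ} (⟨σ_{ℓ e_d}⟩^+ - ⟨σ_{ℓ e_d}⟩^-)` for the field `s / i_d ^ δ`. -/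
def magnetizationGap (d : ℕ) (J δ s : ℝ) (ℓ : ℕ) : ℝ :=
  1 / (ℓ : ℝ) ^ δ *
    (limitState d J (decayingField d δ s) 1 (spinAt (axisSite d ℓ)) -
      limitState d J (decayingField d δ s) (-1) (spinAt (axisSite d ℓ)))

end

end SemiInfiniteIsing

open SemiInfiniteIsing

/-! A global spin flip turns the minus boundary condition with field `h` into the plus one with
field `-h`, so it suffices to study plus boundary conditions in the fields `s / i_d ^ δ` with `s`
real of either sign. The FKG inequality holds for fields of any sign and makes plus-expectations of
increasing functions decrease as the volume grows (`plusMean_anti`). Together with horizontal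
translation invariance this gives `exists_averageTendsto`: the average over the wall of the
translates of an observable has the same limit as the observable itself.

Two interpolations turn this into statements about free energies. The semi-infinite model is the
model on `ℤ^d` with coupling `0` on the edges crossing the wall. In zero field, `Z_n²` is therefore
the partition function of `Δ_n` with that coupling, and raising it from `0` to `J` leads to `Q`; the
logarithmic derivative is a sum of two-point functions across the wall, whence a limit `F`
(`tendsto_surfaceEnergySeq_zero`). Switching on the field has as its derivative, per wall site,
`boxMagnetization`, which tends to `wallMagnetization` by dominated convergence because `∑ ℓ^{-δ}`
is finite.

Writing `W` for `wallMagnetization`, the two surface energies are `F - ∫_0^λ W` and `F - ∫_0^{-λ} W`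
with the same `F`. Their difference is the integral of `W` over `[-λ, λ]`; folding it at `0` gives
the integrand `W(s) + W(-s)`, which is the series of magnetization gaps. -/

namespace SemiInfiniteIsing

noncomputable section

/-! ### Ising models with edge-dependent couplings and plus boundary condition -/

section PlusBoundary

/-- The value of `σ_i σ_j` on the edge `{i, j}`. -/
def bond {V : Type*} (σ : V → ℤˣ) (e : Sym2 V) : ℝ := (e.map fun i => spin (σ i)).mul

@[simp] theorem bond_mk {V : Type*} (σ : V → ℤˣ) (i j : V) : bond σ s(i, j) =
    spin (σ i) * spin (σ j) := by
  simp [bond]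

variable {V : Type*} [DecidableEq V]

@[simp] theorem glue_of_mem {Λ : Finset V} {η : V → ℤˣ} {τ : Λ → ℤˣ} {i : V} (hi : i ∈ Λ) :
    glue Λ η τ i = τ ⟨i, hi⟩ := dif_pos hi

@[simp] theorem glue_of_notMem {Λ : Finset V} {η : V → ℤˣ} {τ : Λ → ℤˣ} {i : V} (hi : i ∉ Λ) :
    glue Λ η τ i = η i := dif_neg hi

theorem glue_injective (Λ : Finset V) (η : V → ℤˣ) : Function.Injective (glue Λ η) := by
  intro τ τ' h
  funext i
  simpa using congrFun h i.1

theorem glue_restrict {Λ : Finset V} {η σ : V → ℤˣ} (h : ∀ i ∉ Λ, σ i = η i) :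
    glue Λ η (fun i => σ i) = σ := by
  funext i
  by_cases hi : i ∈ Λ
  · simp [hi]
  · simp [hi, h i hi]

/-- The configurations equal to `+` outside `Λ`. -/
def configs (Λ : Finset V) : Finset (V → ℤˣ) :=
  Finset.univ.map ⟨glue Λ 1, glue_injective Λ 1⟩

theorem mem_configs {Λ : Finset V} {σ : V → ℤˣ} : σ ∈ configs Λ ↔ ∀ i ∉ Λ, σ i = 1 := by
  simp only [configs, Finset.mem_map, Finset.mem_univ, true_and, Function.Embedding.coeFn_mk]
  constructor
  · rintro ⟨τ, rfl⟩ i hi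
    simp [hi]
  · exact fun h => ⟨_, glue_restrict h⟩

theorem sum_configs (Λ : Finset V) (F : (V → ℤˣ) → ℝ) :
    ∑ σ ∈ configs Λ, F σ = ∑ τ : Λ → ℤˣ, F (glue Λ 1 τ) := by
  simp [configs]

theorem one_mem_configs (Λ : Finset V) : (1 : V → ℤˣ) ∈ configs Λ :=
  mem_configs.2 fun _ _ => rfl

theorem spin_eq_or (u : ℤˣ) : spin u = 1 ∨ spin u = -1 := by
  rcases Int.units_eq_one_or u with rfl | rfl <;> simp [spin]

@[simp] theorem spin_one : spin 1 = 1 := by simp [spin]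

@[simp] theorem spin_neg (u : ℤˣ) : spin (-u) = -spin u := by simp [spin]

theorem abs_spin (u : ℤˣ) : |spin u| = 1 := by
  rcases spin_eq_or u with h | h <;> simp [h]

theorem spin_monotone : Monotone spin := by
  intro u v h
  have h' : (u : ℤ) ≤ (v : ℤ) := h
  exact Int.cast_le.2 h'

theorem spin_inf_add_sup (u v : ℤˣ) : spin (u ⊓ v) + spin (u ⊔ v) = spin u + spin v := by
  rcases le_total u v with h | h <;> simp [h, add_comm]

/-- If the two pairs are ordered the same way, both sides agree; otherwise the difference is a
product of two nonnegative increments. -/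
theorem spin_mul_supermodular (a b a' b' : ℤˣ) :
    spin a * spin b + spin a' * spin b' ≤
      spin (a ⊓ a') * spin (b ⊓ b') + spin (a ⊔ a') * spin (b ⊔ b') := by
  rcases le_total a a' with h | h <;> rcases le_total b b' with h' | h' <;>
    simp only [h, h', inf_of_le_left, inf_of_le_right, sup_of_le_left, sup_of_le_right] <;>
    nlinarith [spin_monotone h, spin_monotone h',
      mul_nonneg (sub_nonneg.2 (spin_monotone h)) (sub_nonneg.2 (spin_monotone h'))]

theorem mem_touchingEdges {G : SimpleGraph V} [G.LocallyFinite] {Λ : Finset V} {e : Sym2 V} :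
    e ∈ touchingEdges G Λ ↔ e ∈ G.edgeSet ∧ ∃ i ∈ Λ, i ∈ e := by
  simp only [touchingEdges, Finset.mem_biUnion, SimpleGraph.mem_incidenceFinset,
    SimpleGraph.incidenceSet, Set.mem_ofPred_eq]
  tauto

/-- The negative of the Hamiltonian with coupling `K e` on the edge `e`. -/
def energy (G : SimpleGraph V) [G.LocallyFinite] (K : Sym2 V → ℝ) (h : V → ℝ) (Λ : Finset V)
    (σ : V → ℤˣ) : ℝ :=
  ∑ e ∈ touchingEdges G Λ, K e * bond σ e + ∑ i ∈ Λ, h i * spin (σ i)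

/-- The sum of `f` against the Gibbs weights in `Λ` with `+` boundary condition. -/
def gibbsSum (G : SimpleGraph V) [G.LocallyFinite] (K : Sym2 V → ℝ) (h : V → ℝ) (Λ : Finset V)
    (f : (V → ℤˣ) → ℝ) : ℝ :=
  ∑ σ ∈ configs Λ, f σ * Real.exp (energy G K h Λ σ)

/-- The Gibbs expectation in `Λ` with `+` boundary condition. -/
def plusMean (G : SimpleGraph V) [G.LocallyFinite] (K : Sym2 V → ℝ) (h : V → ℝ) (Λ : Finset V)
    (f : (V → ℤˣ) → ℝ) : ℝ :=
  gibbsSum G K h Λ f / gibbsSum G K h Λ 1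

variable (G : SimpleGraph V) [G.LocallyFinite] (K : Sym2 V → ℝ) (h : V → ℝ)

theorem gibbsSum_one_pos (Λ : Finset V) : 0 < gibbsSum G K h Λ 1 :=
  Finset.sum_pos (fun σ _ => by simpa using Real.exp_pos _) ⟨1, one_mem_configs Λ⟩

theorem gibbsSum_add (Λ : Finset V) (f g : (V → ℤˣ) → ℝ) :
    gibbsSum G K h Λ (f + g) = gibbsSum G K h Λ f + gibbsSum G K h Λ g := by
  simp [gibbsSum, add_mul, Finset.sum_add_distrib]

theorem gibbsSum_smul (Λ : Finset V) (c : ℝ) (f : (V → ℤˣ) → ℝ) :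
    gibbsSum G K h Λ (c • f) = c * gibbsSum G K h Λ f := by
  simp [gibbsSum, Finset.mul_sum, mul_assoc]

theorem plusMean_add (Λ : Finset V) (f g : (V → ℤˣ) → ℝ) :
    plusMean G K h Λ (f + g) = plusMean G K h Λ f + plusMean G K h Λ g := by
  simp [plusMean, gibbsSum_add, add_div]

theorem plusMean_smul (Λ : Finset V) (c : ℝ) (f : (V → ℤˣ) → ℝ) :
    plusMean G K h Λ (c • f) = c * plusMean G K h Λ f := by
  simp [plusMean, gibbsSum_smul, mul_div_assoc]

@[simp] theorem plusMean_one (Λ : Finset V) : plusMean G K h Λ 1 = 1 :=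
  div_self (gibbsSum_one_pos G K h Λ).ne'

theorem plusMean_sum {ι : Type*} (s : Finset ι) (Λ : Finset V) (f : ι → (V → ℤˣ) → ℝ) :
    plusMean G K h Λ (fun σ => ∑ i ∈ s, f i σ) = ∑ i ∈ s, plusMean G K h Λ (f i) := by
  simp only [plusMean, gibbsSum, Finset.sum_mul, ← Finset.sum_div]
  rw [Finset.sum_comm]

theorem plusMean_mono (Λ : Finset V) {f g : (V → ℤˣ) → ℝ} (hfg : ∀ σ, f σ ≤ g σ) :
    plusMean G K h Λ f ≤ plusMean G K h Λ g :=
  div_le_div_of_nonneg_right (Finset.sum_le_sum fun σ _ =>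
    mul_le_mul_of_nonneg_right (hfg σ) (Real.exp_pos _).le) (gibbsSum_one_pos G K h Λ).le

theorem abs_plusMean_le (Λ : Finset V) {f : (V → ℤˣ) → ℝ} {c : ℝ} (hf : ∀ σ, |f σ| ≤ c) :
    |plusMean G K h Λ f| ≤ c := by
  have hc : plusMean G K h Λ (c • 1) = c := by simp [plusMean_smul]
  have hc' : plusMean G K h Λ ((-c) • 1) = -c := by simp only [plusMean_smul, plusMean_one, mul_one]
  rw [abs_le]
  constructor
  · rw [← hc']
    exact plusMean_mono G K h Λ fun σ => by simpa using (abs_le.1 (hf σ)).1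
  · conv_rhs => rw [← hc]
    exact plusMean_mono G K h Λ fun σ => by simpa using (abs_le.1 (hf σ)).2

variable {K}

/-- This is the FKG lattice condition for the Gibbs weights. The field terms balance exactly, so `h`
may have any sign; the reduction of the minus boundary condition to the plus one relies on this. -/
theorem energy_supermodular (hK : ∀ e, 0 ≤ K e) (Λ : Finset V) (σ σ' : V → ℤˣ) :
    energy G K h Λ σ + energy G K h Λ σ' ≤
      energy G K h Λ (σ ⊓ σ') + energy G K h Λ (σ ⊔ σ') := by
  have h1 : ∑ e ∈ touchingEdges G Λ, K e * bond σ e + ∑ e ∈ touchingEdges G Λ, K e * bond σ' e ≤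
      ∑ e ∈ touchingEdges G Λ, K e * bond (σ ⊓ σ') e +
        ∑ e ∈ touchingEdges G Λ, K e * bond (σ ⊔ σ') e := by
    rw [← Finset.sum_add_distrib, ← Finset.sum_add_distrib]
    refine Finset.sum_le_sum fun e _ => ?_
    rw [← mul_add, ← mul_add]
    refine mul_le_mul_of_nonneg_left ?_ (hK e)
    induction e with
    | h i j => simpa using spin_mul_supermodular _ _ _ _
  have h2 : ∑ i ∈ Λ, h i * spin (σ i) + ∑ i ∈ Λ, h i * spin (σ' i) =
      ∑ i ∈ Λ, h i * spin ((σ ⊓ σ') i) + ∑ i ∈ Λ, h i * spin ((σ ⊔ σ') i) := by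
    rw [← Finset.sum_add_distrib, ← Finset.sum_add_distrib]
    refine Finset.sum_congr rfl fun i _ => ?_
    rw [← mul_add, ← mul_add, Pi.inf_apply, Pi.sup_apply, spin_inf_add_sup]
  unfold energy
  linarith

/-- The FKG inequality for ferromagnetic Ising models in arbitrary fields. -/
theorem gibbsSum_mul_le (hK : ∀ e, 0 ≤ K e) (Λ : Finset V) {f g : (V → ℤˣ) → ℝ}
    (hf0 : ∀ σ, 0 ≤ f σ) (hg0 : ∀ σ, 0 ≤ g σ) (hf : Monotone f) (hg : Monotone g) :
    gibbsSum G K h Λ f * gibbsSum G K h Λ g ≤ gibbsSum G K h Λ 1 * gibbsSum G K h Λ (f * g) := by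
  have hmono : Monotone (glue Λ (1 : V → ℤˣ)) := by
    intro τ τ' h i
    by_cases hi : i ∈ Λ
    · simpa [hi] using h ⟨i, hi⟩
    · simp [hi]
  have hinf (τ τ' : Λ → ℤˣ) : glue Λ 1 (τ ⊓ τ') = glue Λ 1 τ ⊓ glue Λ 1 τ' := by
    funext i
    by_cases hi : i ∈ Λ <;> simp [hi]
  have hsup (τ τ' : Λ → ℤˣ) : glue Λ 1 (τ ⊔ τ') = glue Λ 1 τ ⊔ glue Λ 1 τ' := by
    funext i
    by_cases hi : i ∈ Λ <;> simp [hi]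
  have key := fkg (fun τ : Λ → ℤˣ => f (glue Λ 1 τ)) (fun τ => g (glue Λ 1 τ))
    (fun τ => Real.exp (energy G K h Λ (glue Λ 1 τ))) (fun _ => (Real.exp_pos _).le)
    (fun _ => hf0 _) (fun _ => hg0 _) (fun _ _ hab => hf (hmono hab))
    (fun _ _ hab => hg (hmono hab)) fun a b => by
      rw [← Real.exp_add, ← Real.exp_add, hinf, hsup]
      exact Real.exp_le_exp.2 (energy_supermodular G h hK Λ _ _)
  simpa [gibbsSum, sum_configs, mul_comm] using key

/-- An edge touching `Λ'` but not `Λ` has both endpoints outside `Λ`, where all spins are `+`; its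
contribution is therefore constant. -/
theorem energy_eq_of_subset {Λ Λ' : Finset V} (hΛ : Λ ⊆ Λ') :
    ∃ c, ∀ σ ∈ configs Λ, energy G K h Λ' σ = energy G K h Λ σ + c := by
  have hE : touchingEdges G Λ ⊆ touchingEdges G Λ' := Finset.biUnion_subset_biUnion_of_subset_left _ hΛ
  refine ⟨∑ e ∈ touchingEdges G Λ' \ touchingEdges G Λ, K e + ∑ i ∈ Λ' \ Λ, h i, fun σ hσ => ?_⟩
  rw [mem_configs] at hσ
  have h1 : ∑ e ∈ touchingEdges G Λ' \ touchingEdges G Λ, K e * bond σ e =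
      ∑ e ∈ touchingEdges G Λ' \ touchingEdges G Λ, K e := by
    refine Finset.sum_congr rfl fun e he => ?_
    rw [Finset.mem_sdiff, mem_touchingEdges, mem_touchingEdges] at he
    have hne : ∀ i ∈ e, σ i = 1 := fun i hi =>
      hσ i fun hiΛ => he.2 ⟨he.1.1, i, hiΛ, hi⟩
    induction e with
    | h i j => simp [hne i (by simp), hne j (by simp)]
  have h2 : ∑ i ∈ Λ' \ Λ, h i * spin (σ i) = ∑ i ∈ Λ' \ Λ, h i :=
    Finset.sum_congr rfl fun i hi => by simp [hσ i (Finset.mem_sdiff.1 hi).2]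
  unfold energy
  rw [← Finset.sum_sdiff hE, ← Finset.sum_sdiff hΛ, h1, h2]
  ring

/-- With `+` boundary condition, expectations of increasing functions decrease with the volume. -/
theorem plusMean_anti (hK : ∀ e, 0 ≤ K e) {Λ Λ' : Finset V} (hΛ : Λ ⊆ Λ')
    {f : (V → ℤˣ) → ℝ} (hf0 : ∀ σ, 0 ≤ f σ) (hf : Monotone f) :
    plusMean G K h Λ' f ≤ plusMean G K h Λ f := by
  classical
  obtain ⟨c, hc⟩ := energy_eq_of_subset G (K := K) h hΛ
  -- The indicator that all spins in `Λ' \ Λ` are `+` is increasing. Conditioning the measure in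
  -- `Λ'` on this event gives the measure in `Λ`, and by FKG the conditioning can only raise the
  -- mean of `f`.
  set g : (V → ℤˣ) → ℝ := fun σ => if ∀ i ∈ Λ' \ Λ, σ i = 1 then 1 else 0 with hg
  have hle (u : ℤˣ) : u ≤ 1 := by
    rcases Int.units_eq_one_or u with rfl | rfl <;> decide
  have hgm : Monotone g := by
    intro σ σ' hσ
    by_cases h1 : ∀ i ∈ Λ' \ Λ, σ i = 1
    · have h2 : ∀ i ∈ Λ' \ Λ, σ' i = 1 := fun i hi =>
        le_antisymm (hle _) ((h1 i hi).symm.le.trans (hσ i))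
      simp only [hg]
      rw [if_pos h1, if_pos h2]
    · simp only [hg]
      rw [if_neg h1]
      split_ifs <;> norm_num
  have hg0 (σ) : 0 ≤ g σ := by
    simp only [hg]
    split_ifs <;> norm_num
  have hconf : (configs Λ').filter (fun σ => ∀ i ∈ Λ' \ Λ, σ i = 1) = configs Λ := by
    ext σ
    simp only [Finset.mem_filter, mem_configs, Finset.mem_sdiff]
    constructor
    · rintro ⟨h1, h2⟩ i hi
      by_cases hi' : i ∈ Λ'
      · exact h2 i ⟨hi', hi⟩
      · exact h1 i hi'
    · exact fun h1 => ⟨fun i hi => h1 i fun h => hi (hΛ h), fun i hi => h1 i hi.2⟩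
  have hsum (F : (V → ℤˣ) → ℝ) :
      gibbsSum G K h Λ' (F * g) = Real.exp c * gibbsSum G K h Λ F := by
    unfold gibbsSum
    rw [← hconf, Finset.sum_filter, Finset.mul_sum]
    refine Finset.sum_congr rfl fun σ hσ => ?_
    by_cases h1 : ∀ i ∈ Λ' \ Λ, σ i = 1
    · have h2 : σ ∈ configs Λ := hconf ▸ Finset.mem_filter.2 ⟨hσ, h1⟩
      have h3 : g σ = 1 := if_pos h1
      rw [if_pos h1, Pi.mul_apply, hc σ h2, h3, Real.exp_add]
      ring
    · have h3 : g σ = 0 := if_neg h1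
      rw [if_neg h1, Pi.mul_apply, h3]
      ring
  have key := gibbsSum_mul_le G h hK Λ' hf0 hg0 hf hgm
  have h1 := hsum 1
  rw [one_mul] at h1
  rw [h1, hsum f] at key
  unfold plusMean
  rw [div_le_div_iff₀ (gibbsSum_one_pos ..) (gibbsSum_one_pos ..)]
  have := Real.exp_pos c
  nlinarith

end PlusBoundary

/-! ### Automorphisms -/

section Automorphism

variable {V : Type*} [DecidableEq V] (G : SimpleGraph V) [G.LocallyFinite] {K : Sym2 V → ℝ}
  {h : V → ℝ} (g : G ≃g G)

theorem sum_configs_map (g : V ≃ V) (Λ : Finset V) (F : (V → ℤˣ) → ℝ) :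
    ∑ σ ∈ configs (Λ.map g.toEmbedding), F σ = ∑ σ ∈ configs Λ, F (σ ∘ g.symm) := by
  refine Finset.sum_bij' (fun σ _ => σ ∘ g) (fun σ _ => σ ∘ g.symm) ?_ ?_ ?_ ?_ ?_
  · intro σ hσ
    rw [mem_configs] at hσ ⊢
    exact fun i hi => hσ _ (by simpa using hi)
  · intro σ hσ
    rw [mem_configs] at hσ ⊢
    exact fun i hi => hσ _ (by simpa [Finset.mem_map_equiv] using hi)
  · intro σ _
    funext i
    simp
  · intro σ _
    funext i
    simp
  · intro σ _
    congr 1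
    funext i
    simp

theorem bond_map {V : Type*} (g : V ≃ V) (σ : V → ℤˣ) (e : Sym2 V) :
    bond (σ ∘ g.symm) (e.map g) = bond σ e := by
  induction e with
  | h i j => simp

variable (hK : ∀ e, K (e.map g) = K e) (hh : ∀ i, h (g i) = h i)
include hK hh

theorem energy_map (Λ : Finset V) (σ : V → ℤˣ) :
    energy G K h (Λ.map g.toEquiv.toEmbedding) (σ ∘ g.symm) = energy G K h Λ σ := by
  have hedge (g : G ≃g G) {e : Sym2 V} (he : e ∈ G.edgeSet) : e.map g ∈ G.edgeSet := by
    induction e with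
    | h i j => exact g.map_adj_iff.2 he
  unfold energy
  congr 1
  · symm
    refine Finset.sum_bij' (fun e _ => e.map g) (fun e _ => e.map g.symm) ?_ ?_ ?_ ?_ ?_
    · intro e he
      rw [mem_touchingEdges] at he ⊢
      obtain ⟨h1, i, hi, hie⟩ := he
      exact ⟨hedge g h1, g i, Finset.mem_map_of_mem _ hi, Sym2.mem_map.2 ⟨i, hie, rfl⟩⟩
    · intro e he
      rw [mem_touchingEdges] at he ⊢
      obtain ⟨h1, i, hi, hie⟩ := he
      exact ⟨hedge g.symm h1, g.symm i, Finset.mem_map_equiv.1 hi,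
        Sym2.mem_map.2 ⟨i, hie, rfl⟩⟩
    · intro e _
      induction e with
      | h i j => simp
    · intro e _
      induction e with
      | h i j => simp
    · intro e _
      rw [hK]
      congr 1
      exact (bond_map g.toEquiv σ e).symm
  · rw [Finset.sum_map]
    refine Finset.sum_congr rfl fun i _ => ?_
    have h1 : h (g.toEquiv.toEmbedding i) = h i := hh i
    have h2 : (σ ∘ g.symm) (g.toEquiv.toEmbedding i) = σ i := by
      simp
    rw [h1, h2]

theorem gibbsSum_map (Λ : Finset V) (f : (V → ℤˣ) → ℝ) :
    gibbsSum G K h (Λ.map g.toEquiv.toEmbedding) f =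
      gibbsSum G K h Λ fun σ => f (σ ∘ g.symm) := by
  unfold gibbsSum
  rw [sum_configs_map]
  refine Finset.sum_congr rfl fun σ _ => ?_
  congr 2
  exact energy_map G g hK hh Λ σ

theorem plusMean_map (Λ : Finset V) (f : (V → ℤˣ) → ℝ) :
    plusMean G K h (Λ.map g.toEquiv.toEmbedding) f =
      plusMean G K h Λ fun σ => f (σ ∘ g.symm) := by
  unfold plusMean
  rw [gibbsSum_map G g hK hh, gibbsSum_map G g hK hh]
  rfl

end Automorphism

/-! ### Dependence on a parameter -/

section Parameter

variable {V : Type*} [DecidableEq V] (G : SimpleGraph V) [G.LocallyFinite] {K : ℝ → Sym2 V → ℝ}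
  {h : ℝ → V → ℝ} {Λ : Finset V} {E A : (V → ℤˣ) → ℝ}
  (hE : ∀ t, ∀ σ ∈ configs Λ, energy G (K t) (h t) Λ σ = E σ + t * A σ)
include hE

theorem hasDerivAt_gibbsSum (t : ℝ) (f : (V → ℤˣ) → ℝ) :
    HasDerivAt (fun t => gibbsSum G (K t) (h t) Λ f) (gibbsSum G (K t) (h t) Λ (f * A)) t := by
  have h1 (t : ℝ) (f : (V → ℤˣ) → ℝ) : gibbsSum G (K t) (h t) Λ f =
      ∑ σ ∈ configs Λ, f σ * Real.exp (E σ + t * A σ) :=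
    Finset.sum_congr rfl fun σ hσ => by rw [hE t σ hσ]
  rw [funext fun t => h1 t f, h1 t (f * A)]
  refine HasDerivAt.fun_sum fun σ _ => ?_
  have h2 : HasDerivAt (fun t => E σ + t * A σ) (A σ) t := by
    simpa using ((hasDerivAt_id t).mul_const (A σ)).const_add (E σ)
  exact (h2.exp.const_mul (f σ)).congr_deriv (by rw [Pi.mul_apply]; ring)

theorem continuous_plusMean (f : (V → ℤˣ) → ℝ) :
    Continuous fun t => plusMean G (K t) (h t) Λ f := by
  have h1 (f : (V → ℤˣ) → ℝ) : Continuous fun t => gibbsSum G (K t) (h t) Λ f :=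
    continuous_iff_continuousAt.2 fun t => (hasDerivAt_gibbsSum G hE t f).continuousAt
  exact (h1 f).div (h1 1) fun t => (gibbsSum_one_pos G (K t) (h t) Λ).ne'

/-- For an energy affine in `t` with slope `A`, the logarithmic derivative of the partition function
is the mean of `A`. It is applied to the coupling across the wall and to the strength of the field.
-/
theorem integral_plusMean (a b : ℝ) :
    ∫ t in a..b, plusMean G (K t) (h t) Λ A =
      Real.log (gibbsSum G (K b) (h b) Λ 1) - Real.log (gibbsSum G (K a) (h a) Λ 1) := by
  refine intervalIntegral.integral_eq_sub_of_hasDerivAt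
    (f := fun t => Real.log (gibbsSum G (K t) (h t) Λ 1)) (fun t _ => ?_)
    ((continuous_plusMean G hE A).intervalIntegrable a b)
  have h1 := (hasDerivAt_gibbsSum G hE t 1).log (gibbsSum_one_pos G (K t) (h t) Λ).ne'
  rwa [one_mul] at h1

end Parameter

/-! ### Factorization over decoupled volumes -/

section Factorization

variable {V : Type*} [DecidableEq V] (G : SimpleGraph V) [G.LocallyFinite] {K : Sym2 V → ℝ}
  (h : V → ℝ) {A B : Finset V}

/-- The boundary spin `+` is the unit of `ℤˣ`, so the pointwise product pastes a configuration in
`A` and one in `B` together. -/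
theorem sum_configs_union (hAB : Disjoint A B) (F : (V → ℤˣ) → ℝ) :
    ∑ σ ∈ configs (A ∪ B), F σ = ∑ σ ∈ configs A, ∑ σ' ∈ configs B, F (σ * σ') := by
  rw [← Finset.sum_product']
  symm
  refine Finset.sum_bij' (fun p _ => p.1 * p.2)
    (fun σ _ => (fun i => if i ∈ A then σ i else 1, fun i => if i ∈ B then σ i else 1))
    ?_ ?_ ?_ ?_ ?_
  · rintro ⟨σ, σ'⟩ hσ
    simp only [Finset.mem_product, mem_configs, Finset.mem_union, not_or] at hσ ⊢
    intro i hi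
    simp [hσ.1 i hi.1, hσ.2 i hi.2]
  · intro σ _
    simp only [Finset.mem_product, mem_configs]
    exact ⟨fun i hi => if_neg hi, fun i hi => if_neg hi⟩
  · rintro ⟨σ, σ'⟩ hσ
    simp only [Finset.mem_product, mem_configs] at hσ
    ext i
    · by_cases hi : i ∈ A
      · simp [hi, hσ.2 i (Finset.disjoint_left.1 hAB hi)]
      · simp [hi, hσ.1 i hi]
    · by_cases hi : i ∈ B
      · simp [hi, hσ.1 i (Finset.disjoint_right.1 hAB hi)]
      · simp [hi, hσ.2 i hi]
  · intro σ hσ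
    rw [mem_configs] at hσ
    funext i
    by_cases hA : i ∈ A
    · simp [hA, Finset.disjoint_left.1 hAB hA]
    · by_cases hB : i ∈ B
      · simp [hA, hB]
      · simp [hA, hB, hσ i (by simp [hA, hB])]
  · intro _ _
    rfl

/-- Edges touching both volumes carry no coupling, and an edge touching only one of them does not
see the other factor, which is `+` at both endpoints. -/
theorem energy_union (hAB : Disjoint A B)
    (hK : ∀ e ∈ touchingEdges G A, e ∈ touchingEdges G B → K e = 0)
    {σ σ' : V → ℤˣ} (hσ : σ ∈ configs A) (hσ' : σ' ∈ configs B) :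
    energy G K h (A ∪ B) (σ * σ') = energy G K h A σ + energy G K h B σ' := by
  rw [mem_configs] at hσ hσ'
  have hu : touchingEdges G (A ∪ B) = touchingEdges G A ∪ touchingEdges G B := by
    ext e
    simp only [mem_touchingEdges, Finset.mem_union]
    grind
  have hi : ∑ e ∈ touchingEdges G A ∩ touchingEdges G B, K e * bond (σ * σ') e = 0 := by
    refine Finset.sum_eq_zero fun e he => ?_
    rw [hK e (Finset.mem_inter.1 he).1 (Finset.mem_inter.1 he).2, zero_mul]
  have hA : ∑ e ∈ touchingEdges G A, K e * bond (σ * σ') e =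
      ∑ e ∈ touchingEdges G A, K e * bond σ e := by
    refine Finset.sum_congr rfl fun e he => ?_
    by_cases hB : e ∈ touchingEdges G B
    · rw [hK e he hB, zero_mul, zero_mul]
    · have hne : ∀ i ∈ e, σ' i = 1 := fun i hie => hσ' i fun hiB =>
        hB (mem_touchingEdges.2 ⟨(mem_touchingEdges.1 he).1, i, hiB, hie⟩)
      induction e with
      | h i j => simp [hne i (by simp), hne j (by simp)]
  have hB : ∑ e ∈ touchingEdges G B, K e * bond (σ * σ') e =
      ∑ e ∈ touchingEdges G B, K e * bond σ' e := by
    refine Finset.sum_congr rfl fun e he => ?_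
    by_cases hA : e ∈ touchingEdges G A
    · rw [hK e hA he, zero_mul, zero_mul]
    · have hne : ∀ i ∈ e, σ i = 1 := fun i hie => hσ i fun hiA =>
        hA (mem_touchingEdges.2 ⟨(mem_touchingEdges.1 he).1, i, hiA, hie⟩)
      induction e with
      | h i j => simp [hne i (by simp), hne j (by simp)]
  have hA' : ∑ i ∈ A, h i * spin ((σ * σ') i) = ∑ i ∈ A, h i * spin (σ i) :=
    Finset.sum_congr rfl fun i hi => by simp [hσ' i (Finset.disjoint_left.1 hAB hi)]
  have hB' : ∑ i ∈ B, h i * spin ((σ * σ') i) = ∑ i ∈ B, h i * spin (σ' i) :=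
    Finset.sum_congr rfl fun i hi => by simp [hσ i (Finset.disjoint_right.1 hAB hi)]
  have hsum := Finset.sum_union_inter (s₁ := touchingEdges G A) (s₂ := touchingEdges G B)
    (f := fun e => K e * bond (σ * σ') e)
  rw [hi, add_zero, hA, hB] at hsum
  unfold energy
  rw [hu, hsum, Finset.sum_union hAB, hA', hB']
  ring

theorem gibbsSum_one_union (hAB : Disjoint A B)
    (hK : ∀ e ∈ touchingEdges G A, e ∈ touchingEdges G B → K e = 0) :
    gibbsSum G K h (A ∪ B) 1 = gibbsSum G K h A 1 * gibbsSum G K h B 1 := by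
  unfold gibbsSum
  rw [sum_configs_union hAB, Finset.sum_mul_sum]
  refine Finset.sum_congr rfl fun σ hσ => Finset.sum_congr rfl fun σ' hσ' => ?_
  rw [energy_union G h hAB hK hσ hσ', Real.exp_add]
  simp

end Factorization

/-! ### Uniform couplings and spin flip -/

section SpinFlip

variable {V : Type*} [DecidableEq V] (G : SimpleGraph V) [G.LocallyFinite] (J : ℝ) (h : V → ℝ)
  (Λ : Finset V)

theorem neg_hamiltonian (σ : V → ℤˣ) :
    -hamiltonian G J h Λ σ = energy G (fun _ => J) h Λ σ := by
  simp only [hamiltonian, energy, bond]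
  ring

theorem partitionFunction_one :
    partitionFunction G J h Λ 1 = gibbsSum G (fun _ => J) h Λ 1 := by
  simp [partitionFunction, gibbsSum, neg_hamiltonian, sum_configs]

theorem gibbsExpectation_one (f : (V → ℤˣ) → ℝ) :
    gibbsExpectation G J h Λ 1 f = plusMean G (fun _ => J) h Λ f := by
  rw [gibbsExpectation, plusMean, partitionFunction_one]
  simp [gibbsSum, neg_hamiltonian, sum_configs]

theorem glue_neg (τ : Λ → ℤˣ) : glue Λ (-1) (-τ) = -glue Λ 1 τ := by
  funext i
  by_cases hi : i ∈ Λ <;> simp [hi]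

theorem energy_neg (K : Sym2 V → ℝ) (σ : V → ℤˣ) :
    energy G K h Λ (-σ) = energy G K (-h) Λ σ := by
  have hb (e : Sym2 V) : bond (-σ) e = bond σ e := by
    induction e with
    | h i j => simp
  simp [energy, hb]

theorem sum_glue_neg (F : (V → ℤˣ) → ℝ) :
    ∑ τ : Λ → ℤˣ, F (glue Λ (-1) τ) = ∑ τ : Λ → ℤˣ, F (-glue Λ 1 τ) := by
  rw [← Equiv.sum_comp (Equiv.neg (Λ → ℤˣ)) fun τ => F (glue Λ (-1) τ)]
  simp [glue_neg]

/-- Flipping every spin preserves all products `σ_i σ_j`, exchanges the two boundary conditions and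
reverses the field. -/
theorem partitionFunction_neg_one :
    partitionFunction G J h Λ (-1) = partitionFunction G J (-h) Λ 1 := by
  unfold partitionFunction
  rw [sum_glue_neg Λ fun σ => Real.exp (-hamiltonian G J h Λ σ)]
  simp only [neg_hamiltonian, energy_neg]

theorem gibbsExpectation_neg_one (f : (V → ℤˣ) → ℝ) :
    gibbsExpectation G J h Λ (-1) f = gibbsExpectation G J (-h) Λ 1 fun σ => f (-σ) := by
  unfold gibbsExpectation
  rw [sum_glue_neg Λ fun σ => f σ * Real.exp (-hamiltonian G J h Λ σ), partitionFunction_neg_one]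
  simp only [neg_hamiltonian, energy_neg]

end SpinFlip

/-! ### The lattice with a modified coupling across the wall -/

section Lattice

variable {d : ℕ}

/-- The edges of `ℤ^d` crossing the hyperplane `i_d = 1/2`. -/
def crossing (d : ℕ) : Set (Sym2 (Site d)) := Set.range fun x => s((x, 1), (x, 0))

open Classical in
/-- The coupling equal to `t` on the edges crossing the hyperplane `i_d = 1/2`, and to `J` on the
others. -/
def coupling (d : ℕ) (J t : ℝ) (e : Sym2 (Site d)) : ℝ := if e ∈ crossing d then t else J

theorem coupling_nonneg {J t : ℝ} (hJ : 0 ≤ J) (ht : 0 ≤ t) (e : Sym2 (Site d)) :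
    0 ≤ coupling d J t e := by
  unfold coupling
  split_ifs <;> assumption

theorem coupling_self (J : ℝ) : coupling d J J = fun _ => J := by
  funext e
  simp [coupling]

theorem lattice_adj {i j : Site d} :
    (lattice d).Adj i j ↔ (∑ k, |i.1 k - j.1 k|) + |i.2 - j.2| = 1 := Iff.rfl

/-- The vertical distance is at least `1`, which exhausts the total distance; hence the horizontal
parts agree and the heights are exactly `1` and `0`. -/
theorem mem_crossing_of_adj {i j : Site d} (h : (lattice d).Adj i j) (hi : 1 ≤ i.2)
    (hj : j.2 ≤ 0) : s(i, j) ∈ crossing d := by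
  rw [lattice_adj] at h
  have h0 : 0 ≤ ∑ k, |i.1 k - j.1 k| := Finset.sum_nonneg fun k _ => abs_nonneg _
  have h1 : i.2 - j.2 ≤ |i.2 - j.2| := le_abs_self _
  have h2 : ∑ k, |i.1 k - j.1 k| = 0 := by omega
  have h3 : i.1 = j.1 := by
    funext k
    have := (Finset.sum_eq_zero_iff_of_nonneg fun k _ => abs_nonneg _).1 h2 k (Finset.mem_univ k)
    exact sub_eq_zero.1 (abs_eq_zero.1 this)
  have h4 : i.2 = 1 := by omega
  have h5 : j.2 = 0 := by omega
  obtain ⟨i1, i2⟩ := i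
  obtain ⟨j1, j2⟩ := j
  simp only at h3 h4 h5
  subst h3 h4 h5
  exact ⟨i1, rfl⟩

/-- The horizontal translation by `x`. -/
def shift (x : Fin (d - 1) → ℤ) : lattice d ≃g lattice d where
  toEquiv := (Equiv.addRight x).prodCongr (Equiv.refl ℤ)
  map_rel_iff' := by
    intro i j
    simp [lattice_adj]

@[simp] theorem shift_apply (x : Fin (d - 1) → ℤ) (i : Site d) :
    shift x i = (i.1 + x, i.2) := rfl

@[simp] theorem shift_symm_apply (x : Fin (d - 1) → ℤ) (i : Site d) :
    (shift x).symm i = (i.1 - x, i.2) := by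
  refine (shift x).toEquiv.symm_apply_eq.2 ?_
  simp [shift]

/-- The reflection in the hyperplane `i_d = 1/2`, as an automorphism of `ℤ^d`. -/
def reflectIso (d : ℕ) : lattice d ≃g lattice d where
  toFun := reflect
  invFun := reflect
  left_inv i := by simp [reflect]
  right_inv i := by simp [reflect]
  map_rel_iff' := by
    intro i j
    simp [lattice_adj, reflect, abs_sub_comm]

theorem map_mem_crossing_iff (g : Site d ≃ Site d)
    (h : ∀ e ∈ crossing d, e.map g ∈ crossing d)
    (h' : ∀ e ∈ crossing d, e.map g.symm ∈ crossing d) (e : Sym2 (Site d)) :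
    e.map g ∈ crossing d ↔ e ∈ crossing d := by
  refine ⟨fun he => ?_, h e⟩
  have := h' _ he
  rwa [Sym2.map_map, g.symm_comp_self, Sym2.map_id, id] at this

theorem coupling_shift (J t : ℝ) (x : Fin (d - 1) → ℤ) (e : Sym2 (Site d)) :
    coupling d J t (e.map (shift x)) = coupling d J t e := by
  have := map_mem_crossing_iff (d := d) (shift x).toEquiv
    (by rintro _ ⟨y, rfl⟩; exact ⟨y + x, rfl⟩)
    (by rintro _ ⟨y, rfl⟩; exact ⟨y - x, rfl⟩) e
  classical
  unfold coupling
  exact if_congr this rfl rfl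

theorem coupling_reflect (J t : ℝ) (e : Sym2 (Site d)) :
    coupling d J t (e.map (reflectIso d)) = coupling d J t e := by
  have := map_mem_crossing_iff (d := d) (reflectIso d).toEquiv
    (by rintro _ ⟨y, rfl⟩; exact ⟨y, by simp [reflectIso, reflect, Sym2.eq_swap]⟩)
    (by rintro _ ⟨y, rfl⟩; exact ⟨y, by simp [reflectIso, reflect, Sym2.eq_swap]⟩) e
  classical
  unfold coupling
  exact if_congr this rfl rfl

theorem mem_box {n : ℕ} {i : Site d} :
    i ∈ box d n ↔ (∀ k, |i.1 k| ≤ n) ∧ 1 ≤ i.2 ∧ i.2 ≤ n := by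
  simp [box, Pi.le_def, abs_le, forall_and]

theorem mem_image_reflect_box {n : ℕ} {i : Site d} :
    i ∈ (box d n).image reflect ↔ (∀ k, |i.1 k| ≤ n) ∧ i.2 ≤ 0 ∧ 1 - (n : ℤ) ≤ i.2 := by
  rw [Finset.mem_image]
  constructor
  · rintro ⟨j, hj, rfl⟩
    rw [mem_box] at hj
    refine ⟨hj.1, ?_, ?_⟩ <;> simp only [reflect] <;> omega
  · intro h
    refine ⟨reflect i, mem_box.2 ⟨h.1, ?_, ?_⟩, by simp [reflect]⟩ <;> simp only [reflect] <;> omega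

theorem mem_doubleBox {n : ℕ} {i : Site d} :
    i ∈ doubleBox d n ↔ (∀ k, |i.1 k| ≤ n) ∧ 1 - (n : ℤ) ≤ i.2 ∧ i.2 ≤ n := by
  rw [doubleBox, Finset.mem_union, mem_box, mem_image_reflect_box]
  grind

/-- The lattice edges at the box that are missing from the half-space are precisely those crossing
the wall, so deleting them amounts to giving them coupling `0`. From here on a single graph,
`lattice d`, carries all the models. -/
theorem energy_halfLattice (J : ℝ) (h : Site d → ℝ) (n : ℕ) (σ : Site d → ℤˣ) :
    energy (halfLattice d) (fun _ => J) h (box d n) σ =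
      energy (lattice d) (coupling d J 0) h (box d n) σ := by
  unfold energy
  congr 1
  have hcross {i j : Site d} (hij : (halfLattice d).Adj i j) : s(i, j) ∉ crossing d := by
    rintro ⟨x, hx⟩
    have h0 : ((x, 0) : Site d) ∈ s(i, j) := by
      rw [← hx]
      simp
    rcases Sym2.mem_iff.1 h0 with rfl | rfl
    · have := hij.1
      simp [halfSpace] at this
    · have := hij.2.1
      simp [halfSpace] at this
  have hsub : touchingEdges (halfLattice d) (box d n) ⊆ touchingEdges (lattice d) (box d n) := by
    intro e he
    rw [mem_touchingEdges] at he ⊢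
    refine ⟨?_, he.2⟩
    induction e with
    | h i j => exact he.1.2.2
  rw [← Finset.sum_subset hsub]
  · refine Finset.sum_congr rfl fun e he => ?_
    rw [mem_touchingEdges] at he
    induction e with
    | h i j => rw [coupling, if_neg (hcross he.1)]
  · intro e he he'
    rw [mem_touchingEdges] at he he'
    obtain ⟨hadj, i, hi, hie⟩ := he
    obtain ⟨j, rfl⟩ := hie
    have hi' := (mem_box.1 hi).2.1
    have hj : j.2 ≤ 0 := by
      by_contra hj
      exact he' ⟨⟨hi', by simp only [halfSpace, Set.mem_ofPred_eq]; omega, hadj⟩, i, hi, by simp⟩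
    rw [coupling, if_pos (mem_crossing_of_adj hadj hi' hj), zero_mul]

theorem boxPartition_one (J : ℝ) (h : Site d → ℝ) (n : ℕ) :
    boxPartition d J h 1 n = gibbsSum (lattice d) (coupling d J 0) h (box d n) 1 := by
  refine (partitionFunction_one (halfLattice d) J h (box d n)).trans ?_
  simp only [gibbsSum, energy_halfLattice]

theorem boxState_one (J : ℝ) (h : Site d → ℝ) (n : ℕ) (f : (Site d → ℤˣ) → ℝ) :
    boxState d J h 1 n f = plusMean (lattice d) (coupling d J 0) h (box d n) f := by
  refine (gibbsExpectation_one (halfLattice d) J h (box d n) f).trans ?_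
  simp only [plusMean, gibbsSum, energy_halfLattice]

theorem boxPartition_neg_one (J : ℝ) (h : Site d → ℝ) (n : ℕ) :
    boxPartition d J h (-1) n = boxPartition d J (-h) 1 n :=
  partitionFunction_neg_one _ _ _ _

theorem boxState_neg_one (J : ℝ) (h : Site d → ℝ) (n : ℕ) (f : (Site d → ℤˣ) → ℝ) :
    boxState d J h (-1) n f = boxState d J (-h) 1 n fun σ => f (-σ) :=
  gibbsExpectation_neg_one _ _ _ _ _

theorem doubleBoxPartition_one (J : ℝ) (n : ℕ) :
    doubleBoxPartition d J 1 n = gibbsSum (lattice d) (coupling d J J) 0 (doubleBox d n) 1 := by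
  rw [coupling_self]
  exact partitionFunction_one _ _ _ _

theorem doubleBoxPartition_neg_one (J : ℝ) (n : ℕ) :
    doubleBoxPartition d J (-1) n = doubleBoxPartition d J 1 n := by
  refine (partitionFunction_neg_one (lattice d) J 0 (doubleBox d n)).trans ?_
  rw [neg_zero]
  rfl

/-- Without coupling across the wall, `Δ_n` splits into the box and its mirror image, which have
equal partition functions by reflection symmetry. This explains the square in the surface free
energy. -/
theorem gibbsSum_doubleBox_decoupled (J : ℝ) (n : ℕ) :
    gibbsSum (lattice d) (coupling d J 0) 0 (doubleBox d n) 1 =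
      gibbsSum (lattice d) (coupling d J 0) 0 (box d n) 1 ^ 2 := by
  have himage : (box d n).image reflect = (box d n).map (reflectIso d).toEquiv.toEmbedding := by
    rw [Finset.map_eq_image]
    rfl
  have hdisj : Disjoint (box d n) ((box d n).image reflect) := by
    refine Finset.disjoint_left.2 fun i hi hi' => ?_
    have h1 := (mem_box.1 hi).2.1
    have h2 := (mem_image_reflect_box.1 hi').2.1
    omega
  rw [doubleBox, gibbsSum_one_union (lattice d) 0 hdisj, sq]
  · congr 1
    rw [himage]
    exact gibbsSum_map (lattice d) (reflectIso d) (coupling_reflect J 0) (fun _ => rfl) _ _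
  · intro e he he'
    rw [mem_touchingEdges] at he he'
    obtain ⟨hadj, i, hi, hie⟩ := he
    obtain ⟨-, j, hj, hje⟩ := he'
    have hij : i ≠ j := fun h => Finset.disjoint_left.1 hdisj hi (h ▸ hj)
    obtain rfl := (Sym2.mem_and_mem_iff hij).1 ⟨hie, hje⟩
    exact if_pos (mem_crossing_of_adj hadj (mem_box.1 hi).2.1 (mem_image_reflect_box.1 hj).2.1)

/-- The horizontal box `[-n, n]^(d-1)`. -/
def horizontalBox (d n : ℕ) : Finset (Fin (d - 1) → ℤ) :=
  Finset.Icc (fun _ => -(n : ℤ)) (fun _ => (n : ℤ))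

theorem mem_horizontalBox {n : ℕ} {x : Fin (d - 1) → ℤ} :
    x ∈ horizontalBox d n ↔ ∀ k, |x k| ≤ n := by
  simp [horizontalBox, Pi.le_def, abs_le, forall_and]

theorem card_horizontalBox (d n : ℕ) : (horizontalBox d n).card = (2 * n + 1) ^ (d - 1) := by
  rw [horizontalBox, Pi.card_Icc]
  simp only [Int.card_Icc, Finset.prod_const, Finset.card_univ, Fintype.card_fin]
  congr 1
  omega

theorem card_wall (d n : ℕ) : (wall d n).card = (horizontalBox d n).card := by
  simp [wall, horizontalBox]

/-- The slope in `t` sums over one crossing edge per wall site. The case `n = 0` is excluded because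
`Δ_0` is empty while the horizontal box still contains the origin. -/
theorem energy_doubleBox (J t : ℝ) {n : ℕ} (hn : 1 ≤ n) (σ : Site d → ℤˣ) :
    energy (lattice d) (coupling d J t) 0 (doubleBox d n) σ =
      energy (lattice d) (coupling d J 0) 0 (doubleBox d n) σ +
        t * ∑ x ∈ horizontalBox d n, spin (σ (x, 1)) * spin (σ (x, 0)) := by
  classical
  have hK (e : Sym2 (Site d)) : coupling d J t e * bond σ e =
      coupling d J 0 e * bond σ e + t * if e ∈ crossing d then bond σ e else 0 := by
    unfold coupling
    split_ifs <;> simp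
  have hfilter : (touchingEdges (lattice d) (doubleBox d n)).filter (· ∈ crossing d) =
      (horizontalBox d n).image fun x => s((x, 1), (x, 0)) := by
    ext e
    simp only [Finset.mem_filter, mem_touchingEdges, Finset.mem_image, mem_horizontalBox]
    constructor
    · rintro ⟨⟨-, i, hi, hie⟩, x, rfl⟩
      refine ⟨x, ?_, rfl⟩
      rw [mem_doubleBox] at hi
      rcases Sym2.mem_iff.1 hie with rfl | rfl <;> exact hi.1
    · rintro ⟨x, hx, rfl⟩
      refine ⟨⟨?_, (x, 1), mem_doubleBox.2 ⟨hx, ?_, ?_⟩, by simp⟩, x, rfl⟩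
      · simp [lattice_adj]
      · simp
      · simpa using hn
  have hinj : Set.InjOn (fun x : Fin (d - 1) → ℤ => (s((x, 1), (x, 0)) : Sym2 (Site d)))
      (horizontalBox d n) := by
    intro x _ y _ hxy
    simpa using hxy
  have hsum : ∑ x ∈ horizontalBox d n, spin (σ (x, 1)) * spin (σ (x, 0)) =
      ∑ e ∈ touchingEdges (lattice d) (doubleBox d n), if e ∈ crossing d then bond σ e else 0 := by
    rw [← Finset.sum_filter, hfilter, Finset.sum_image hinj]
    simp
  unfold energy
  rw [Finset.sum_congr rfl fun e _ => hK e, Finset.sum_add_distrib, ← Finset.mul_sum, hsum]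
  ring

theorem energy_decayingField (K : Sym2 (Site d) → ℝ) (δ s : ℝ) (n : ℕ) (σ : Site d → ℤˣ) :
    energy (lattice d) K (decayingField d δ s) (box d n) σ =
      energy (lattice d) K 0 (box d n) σ +
        s * ∑ k ∈ Finset.range n, ∑ x ∈ horizontalBox d n,
          1 / ((k + 1 : ℕ) : ℝ) ^ δ * spin (σ (x, ((k + 1 : ℕ) : ℤ))) := by
  have h1 : ∑ i ∈ box d n, decayingField d δ s i * spin (σ i) =
      s * ∑ k ∈ Finset.range n, ∑ x ∈ horizontalBox d n,
          1 / ((k + 1 : ℕ) : ℝ) ^ δ * spin (σ (x, ((k + 1 : ℕ) : ℤ))) := by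
    rw [box, Finset.sum_product_right, Finset.mul_sum]
    symm
    refine Finset.sum_bij' (fun k _ => ((k + 1 : ℕ) : ℤ)) (fun l _ => (l - 1).toNat) ?_ ?_ ?_ ?_ ?_
    · intro k hk
      rw [Finset.mem_range] at hk
      rw [Finset.mem_Icc]
      omega
    · intro l hl
      rw [Finset.mem_Icc] at hl
      rw [Finset.mem_range]
      omega
    · intro k _
      simp
    · intro l hl
      rw [Finset.mem_Icc] at hl
      have h0 : 0 ≤ l - 1 := by omega
      show (((l - 1).toNat + 1 : ℕ) : ℤ) = l
      rw [Nat.cast_add, Int.toNat_of_nonneg h0]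
      simp
    · intro k _
      rw [Finset.mul_sum]
      refine Finset.sum_congr rfl fun x _ => ?_
      simp only [decayingField, Int.cast_natCast]
      ring
  simp only [energy, h1, Pi.zero_apply, zero_mul, Finset.sum_const_zero, add_zero]

end Lattice

/-! ### Horizontal averages of local observables -/

section Averages

variable {d : ℕ}

/-- The average over the horizontal translates by `x ∈ [-n, n]^(d-1)` of the expectation of `f`. -/
def horizontalAverage (K : Sym2 (Site d) → ℝ) (h : Site d → ℝ) (Λ : Finset (Site d)) (n : ℕ)
    (f : (Site d → ℤˣ) → ℝ) : ℝ :=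
  1 / ((horizontalBox d n).card : ℝ) *
    ∑ x ∈ horizontalBox d n, plusMean (lattice d) K h Λ fun σ => f (σ ∘ shift x)

/-- The expectations of `f`, and the averages of the expectations of its horizontal translates,
in the volumes `B n` converge to `L`. -/
def AverageTendsto (K : Sym2 (Site d) → ℝ) (h : Site d → ℝ) (B : ℕ → Finset (Site d))
    (f : (Site d → ℤˣ) → ℝ) (L : ℝ) : Prop :=
  Tendsto (fun n => plusMean (lattice d) K h (B n) f) atTop (𝓝 L) ∧
    Tendsto (fun n => horizontalAverage K h (B n) n f) atTop (𝓝 L)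

variable {K : Sym2 (Site d) → ℝ} {h : Site d → ℝ} {B : ℕ → Finset (Site d)}
  {f g : (Site d → ℤˣ) → ℝ} {L M : ℝ}

theorem card_horizontalBox_pos (d n : ℕ) : (0 : ℝ) < (horizontalBox d n).card := by
  rw [card_horizontalBox]
  positivity

theorem AverageTendsto.add (hf : AverageTendsto K h B f L) (hg : AverageTendsto K h B g M) :
    AverageTendsto K h B (f + g) (L + M) := by
  refine ⟨(hf.1.add hg.1).congr fun n => (plusMean_add ..).symm,
    (hf.2.add hg.2).congr fun n => ?_⟩
  rw [horizontalAverage, horizontalAverage, horizontalAverage, ← mul_add, ← Finset.sum_add_distrib]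
  refine congrArg _ (Finset.sum_congr rfl fun x _ => ?_)
  rw [← plusMean_add]
  rfl

theorem AverageTendsto.smul (c : ℝ) (hf : AverageTendsto K h B f L) :
    AverageTendsto K h B (c • f) (c * L) := by
  refine ⟨(hf.1.const_mul c).congr fun n => (plusMean_smul ..).symm,
    (hf.2.const_mul c).congr fun n => ?_⟩
  rw [horizontalAverage, horizontalAverage, mul_left_comm, Finset.mul_sum]
  refine congrArg _ (Finset.sum_congr rfl fun x _ => ?_)
  rw [← plusMean_smul]
  rfl

theorem averageTendsto_one : AverageTendsto K h B 1 1 := by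
  refine ⟨by simp, tendsto_const_nhds.congr fun n => ?_⟩
  have h1 (x : Fin (d - 1) → ℤ) :
      plusMean (lattice d) K h (B n) (fun σ => (1 : (Site d → ℤˣ) → ℝ) (σ ∘ shift x)) = 1 :=
    plusMean_one ..
  rw [horizontalAverage, Finset.sum_congr rfl fun x _ => h1 x]
  simp [(card_horizontalBox_pos d n).ne']

theorem abs_horizontalAverage_le (Λ : Finset (Site d)) (n : ℕ) {c : ℝ} (hf : ∀ σ, |f σ| ≤ c) :
    |horizontalAverage K h Λ n f| ≤ c := by
  have hN := card_horizontalBox_pos d n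
  rw [horizontalAverage, abs_mul, abs_of_pos (by positivity), one_div, inv_mul_le_iff₀ hN,
    ← nsmul_eq_mul]
  exact (Finset.abs_sum_le_sum_abs _ _).trans (Finset.sum_le_card_nsmul _ _ _ fun x _ =>
    abs_plusMean_le _ _ _ _ fun σ => hf _)

/-- A boundary layer of fixed width `k` is a vanishing fraction of the wall: for `n ≥ k` the ratio
is `(1 - 2k / (2n + 1)) ^ (d - 1)`. -/
theorem tendsto_card_horizontalBox_ratio (d k : ℕ) :
    Tendsto (fun n => ((horizontalBox d (n - k)).card : ℝ) / (horizontalBox d n).card) atTop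
      (𝓝 1) := by
  have h1 : Tendsto (fun n : ℕ => (2 * k : ℝ) / (2 * n + 1)) atTop (𝓝 0) := by
    refine Tendsto.div_atTop tendsto_const_nhds ?_
    exact tendsto_atTop_add_const_right _ _
      (tendsto_natCast_atTop_atTop.const_mul_atTop (by norm_num))
  have h2 : Tendsto (fun n : ℕ => (1 - (2 * k : ℝ) / (2 * n + 1)) ^ (d - 1)) atTop (𝓝 1) := by
    simpa using (h1.const_sub 1).pow (d - 1)
  refine h2.congr' ?_
  filter_upwards [eventually_ge_atTop k] with n hn
  rw [card_horizontalBox, card_horizontalBox]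
  push_cast [Nat.cast_sub hn]
  rw [← div_pow]
  congr 1
  field_simp
  ring

/-- In volumes growing in all directions, horizontal averages of increasing observables of a
horizontally invariant model converge to the infinite-volume expectation. -/
theorem exists_averageTendsto (hK0 : ∀ e, 0 ≤ K e) (hK : ∀ x e, K (e.map (shift x)) = K e)
    (hh : ∀ x i, h (shift x i) = h i)
    (hB : ∀ x (n m : ℕ), n ≤ m → (∀ k, |x k| ≤ (m : ℤ) - n) → ∀ i ∈ B n, shift x i ∈ B m)
    (hf0 : ∀ σ, 0 ≤ f σ) (hf : Monotone f) : ∃ L, AverageTendsto K h B f L := by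
  set a : ℕ → ℝ := fun n => plusMean (lattice d) K h (B n) f with ha
  have hmap (x : Fin (d - 1) → ℤ) (n : ℕ) :
      plusMean (lattice d) K h ((B n).map (shift x).toEquiv.toEmbedding)
        (fun σ => f (σ ∘ shift x)) = a n := by
    rw [plusMean_map (lattice d) (shift x) (hK x) (hh x)]
    refine congrArg _ (funext fun σ => congrArg f (funext fun i => ?_))
    simp
  have hfx0 (x : Fin (d - 1) → ℤ) : ∀ σ, 0 ≤ f (σ ∘ shift x) := fun σ => hf0 _
  have hfx (x : Fin (d - 1) → ℤ) : Monotone fun σ : Site d → ℤˣ => f (σ ∘ shift x) :=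
    fun σ σ' hσ => hf fun i => hσ _
  -- A translated observable sees the translated volume: `B n` shifted by `x` lies in `B m`, which
  -- bounds its mean in `B m` from above. In `hlower`, `B n` lies in the shift of `B m` by `x`,
  -- which bounds its mean in `B n` from below.
  have hupper {x : Fin (d - 1) → ℤ} {n m : ℕ} (hnm : n ≤ m) (hx : ∀ k, |x k| ≤ (m : ℤ) - n) :
      plusMean (lattice d) K h (B m) (fun σ => f (σ ∘ shift x)) ≤ a n := by
    rw [← hmap x n]
    refine plusMean_anti (lattice d) h hK0 (fun i hi => ?_) (hfx0 x) (hfx x)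
    obtain ⟨j, hj, rfl⟩ := Finset.mem_map.1 hi
    exact hB x n m hnm hx j hj
  have hlower {x : Fin (d - 1) → ℤ} {n m : ℕ} (hnm : n ≤ m) (hx : ∀ k, |x k| ≤ (m : ℤ) - n) :
      a m ≤ plusMean (lattice d) K h (B n) (fun σ => f (σ ∘ shift x)) := by
    rw [← hmap x m]
    refine plusMean_anti (lattice d) h hK0 (fun i hi => ?_) (hfx0 x) (hfx x)
    have := hB (-x) n m hnm (by simpa using hx) i hi
    rw [Finset.mem_map_equiv]
    convert this using 1
    rw [shift_apply]
    exact (shift_symm_apply x i).trans (by rw [sub_eq_add_neg])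
  have hanti : Antitone a := by
    intro n m hnm
    refine plusMean_anti (lattice d) h hK0 (fun i hi => ?_) hf0 hf
    simpa using hB 0 n m hnm (by simp [hnm]) i hi
  have ha0 (n : ℕ) : 0 ≤ a n := by
    have := plusMean_mono (lattice d) K h (B n) (f := (0 : ℝ) • 1) (g := f) (by simpa using hf0)
    simpa only [plusMean_smul, zero_mul] using this
  have hbdd : BddBelow (Set.range a) := ⟨0, by rintro _ ⟨n, rfl⟩; exact ha0 n⟩
  have hL := tendsto_atTop_ciInf hanti hbdd
  set L := ⨅ n, a n with hLdef
  refine ⟨L, hL, tendsto_order.2 ⟨fun b hb => ?_, fun b hb => ?_⟩⟩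
  -- Every `x` in `[-n, n]^(d-1)` leaves room for the shift inside `B (2n)`, so each term is at
  -- least `a (2n) ≥ L`.
  · filter_upwards with n
    have hN := card_horizontalBox_pos d n
    refine hb.trans_le ?_
    rw [horizontalAverage, one_div, le_inv_mul_iff₀ hN, ← nsmul_eq_mul]
    refine Finset.card_nsmul_le_sum _ _ _ fun x hx => ?_
    rw [mem_horizontalBox] at hx
    exact (ciInf_le hbdd (n + n)).trans (hlower (Nat.le_add_left n n) fun k => by
      have := hx k
      push_cast
      linarith)
  -- Fix `k` with `a k < b`. Translates at distance at least `k` from the edge of the wall are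
  -- bounded by `a k`, and the negligible remainder by `a 0`.
  · obtain ⟨k, hk⟩ := (hL.eventually_lt_const hb).exists
    have hu : Tendsto (fun n => a 0 - ((horizontalBox d (n - k)).card : ℝ) /
        (horizontalBox d n).card * (a 0 - a k)) atTop (𝓝 (a k)) := by
      simpa using ((tendsto_card_horizontalBox_ratio d k).mul_const (a 0 - a k)).const_sub (a 0)
    filter_upwards [hu.eventually_lt_const hk, eventually_ge_atTop k] with n hn hkn
    refine lt_of_le_of_lt ?_ hn
    have hN := card_horizontalBox_pos d n
    have hsub : horizontalBox d (n - k) ⊆ horizontalBox d n := by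
      intro x hx
      rw [mem_horizontalBox] at hx ⊢
      exact fun j => (hx j).trans (by omega)
    have hin : ∑ x ∈ horizontalBox d (n - k),
        plusMean (lattice d) K h (B n) (fun σ => f (σ ∘ shift x)) ≤
          ((horizontalBox d (n - k)).card : ℝ) * a k := by
      rw [← nsmul_eq_mul]
      refine Finset.sum_le_card_nsmul _ _ _ fun x hx => hupper hkn fun j => ?_
      have := mem_horizontalBox.1 hx j
      omega
    have hout : ∑ x ∈ horizontalBox d n \ horizontalBox d (n - k),
        plusMean (lattice d) K h (B n) (fun σ => f (σ ∘ shift x)) ≤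
          (((horizontalBox d n).card : ℝ) - (horizontalBox d (n - k)).card) * a 0 := by
      rw [← Nat.cast_sub (Finset.card_le_card hsub), ← Finset.card_sdiff_of_subset hsub,
        ← nsmul_eq_mul]
      refine Finset.sum_le_card_nsmul _ _ _ fun x hx => hupper n.zero_le fun j => ?_
      simpa using mem_horizontalBox.1 (Finset.mem_sdiff.1 hx).1 j
    rw [horizontalAverage, ← Finset.sum_sdiff hsub, one_div, inv_mul_le_iff₀ hN]
    calc _ ≤ _ := add_le_add hout hin
      _ = _ := by
        field_simp
        ring

theorem shift_mem_box (x : Fin (d - 1) → ℤ) (n m : ℕ) (hnm : n ≤ m)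
    (hx : ∀ k, |x k| ≤ (m : ℤ) - n) (i : Site d) (hi : i ∈ box d n) : shift x i ∈ box d m := by
  rw [mem_box] at hi ⊢
  refine ⟨fun k => ?_, hi.2.1, ?_⟩
  · have h1 := hi.1 k
    have h2 := hx k
    have h3 := abs_add_le (i.1 k) (x k)
    simp only [shift_apply, Pi.add_apply]
    linarith
  · have := hi.2.2
    simp only [shift_apply]
    omega

theorem shift_mem_doubleBox (x : Fin (d - 1) → ℤ) (n m : ℕ) (hnm : n ≤ m)
    (hx : ∀ k, |x k| ≤ (m : ℤ) - n) (i : Site d) (hi : i ∈ doubleBox d n) :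
    shift x i ∈ doubleBox d m := by
  rw [mem_doubleBox] at hi ⊢
  refine ⟨fun k => ?_, ?_⟩
  · have h1 := hi.1 k
    have h2 := hx k
    have h3 := abs_add_le (i.1 k) (x k)
    simp only [shift_apply, Pi.add_apply]
    linarith
  · have := hi.2
    simp only [shift_apply]
    omega

theorem one_add_spinAt_nonneg (i : Site d) (σ : Site d → ℤˣ) :
    0 ≤ (1 + spinAt i) σ := by
  have := (abs_le.1 (abs_spin (σ i)).le).1
  simp only [Pi.add_apply, Pi.one_apply, spinAt]
  linarith

theorem one_add_spinAt_monotone (i : Site d) : Monotone (1 + spinAt i) := by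
  intro σ σ' h
  have := spin_monotone (h i)
  simp only [Pi.add_apply, Pi.one_apply, spinAt]
  linarith

/-- The monotonicity argument needs nonnegative functions, so it is applied to `1 + σ_i` and the
constant is removed by linearity. -/
theorem exists_averageTendsto_spinAt (hK0 : ∀ e, 0 ≤ K e)
    (hK : ∀ x e, K (e.map (shift x)) = K e) (hh : ∀ x i, h (shift x i) = h i)
    (hB : ∀ x (n m : ℕ), n ≤ m → (∀ k, |x k| ≤ (m : ℤ) - n) → ∀ i ∈ B n, shift x i ∈ B m)
    (i : Site d) : ∃ L, AverageTendsto K h B (spinAt i) L := by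
  obtain ⟨L, hL⟩ := exists_averageTendsto hK0 hK hh hB (one_add_spinAt_nonneg i)
    (one_add_spinAt_monotone i)
  refine ⟨L + -1 * 1, ?_⟩
  convert hL.add (averageTendsto_one.smul (-1)) using 1
  funext σ
  simp

/-- The product `σ_i σ_j` is not increasing, but `(1 + σ_i)(1 + σ_j)` is, as a product of
nonnegative increasing functions; expanding it leaves only terms already treated. -/
theorem exists_averageTendsto_spinAt_mul (hK0 : ∀ e, 0 ≤ K e)
    (hK : ∀ x e, K (e.map (shift x)) = K e) (hh : ∀ x i, h (shift x i) = h i)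
    (hB : ∀ x (n m : ℕ), n ≤ m → (∀ k, |x k| ≤ (m : ℤ) - n) → ∀ i ∈ B n, shift x i ∈ B m)
    (i j : Site d) : ∃ L, AverageTendsto K h B (spinAt i * spinAt j) L := by
  obtain ⟨L, hL⟩ := exists_averageTendsto hK0 hK hh hB
    (f := (1 + spinAt i) * (1 + spinAt j))
    (fun σ => mul_nonneg (one_add_spinAt_nonneg i σ) (one_add_spinAt_nonneg j σ))
    (fun σ σ' hσ => mul_le_mul (one_add_spinAt_monotone i hσ) (one_add_spinAt_monotone j hσ)
      (one_add_spinAt_nonneg j σ) (one_add_spinAt_nonneg i σ'))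
  obtain ⟨L₁, hL₁⟩ := exists_averageTendsto_spinAt hK0 hK hh hB i
  obtain ⟨L₂, hL₂⟩ := exists_averageTendsto_spinAt hK0 hK hh hB j
  refine ⟨L + -1 * 1 + -1 * L₁ + -1 * L₂, ?_⟩
  convert ((hL.add (averageTendsto_one.smul (-1))).add (hL₁.smul (-1))).add (hL₂.smul (-1)) using 1
  funext σ
  simp only [Pi.add_apply, Pi.mul_apply, Pi.one_apply, Pi.smul_apply, smul_eq_mul]
  ring

end Averages

/-! ### The surface energy in zero field -/

section ZeroField

variable {d : ℕ}

theorem surfaceEnergySeq_one (J : ℝ) (h : Site d → ℝ) (n : ℕ) :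
    surfaceEnergySeq d J h 1 n = -(1 / (2 * ((horizontalBox d n).card : ℝ))) *
      (2 * Real.log (gibbsSum (lattice d) (coupling d J 0) h (box d n) 1) -
        Real.log (gibbsSum (lattice d) (coupling d J J) 0 (doubleBox d n) 1)) := by
  rw [surfaceEnergySeq, boxPartition_one, doubleBoxPartition_one, card_wall,
    Real.log_div (pow_pos (gibbsSum_one_pos ..) 2).ne' (gibbsSum_one_pos ..).ne', Real.log_pow]
  norm_cast

theorem tendsto_surfaceEnergySeq_zero {J : ℝ} (hJ : 0 ≤ J) :
    ∃ F, Tendsto (surfaceEnergySeq d J 0 1) atTop (𝓝 F) := by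
  set f : (Site d → ℤˣ) → ℝ := spinAt (0, 1) * spinAt (0, 0) with hf
  -- FKG needs `t ≥ 0`. Placing this condition inside the existential lets the choice of limits
  -- define a function on all of `ℝ`; its values at negative `t` are irrelevant.
  have hlim (t : ℝ) : ∃ L, 0 ≤ t → AverageTendsto (coupling d J t) 0 (doubleBox d) f L := by
    by_cases ht : 0 ≤ t
    · obtain ⟨L, hL⟩ := exists_averageTendsto_spinAt_mul (h := 0) (coupling_nonneg (d := d) hJ ht)
        (coupling_shift J t) (fun _ _ => rfl) shift_mem_doubleBox (0, 1) (0, 0)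
      exact ⟨L, fun _ => hL⟩
    · exact ⟨0, fun h => absurd h ht⟩
  choose L hL using hlim
  set A : ℕ → (Site d → ℤˣ) → ℝ := fun n σ =>
    ∑ x ∈ horizontalBox d n, spin (σ (x, 1)) * spin (σ (x, 0)) with hA
  have havg (n : ℕ) (t : ℝ) : horizontalAverage (coupling d J t) 0 (doubleBox d n) n f =
      1 / ((horizontalBox d n).card : ℝ) *
        plusMean (lattice d) (coupling d J t) 0 (doubleBox d n) (A n) := by
    rw [horizontalAverage, hA]
    simp only [plusMean_sum]
    simp [hf, spinAt]
  have hcont (n : ℕ) (hn : 1 ≤ n) :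
      Continuous fun t => horizontalAverage (coupling d J t) 0 (doubleBox d n) n f := by
    simp only [havg]
    exact continuous_const.mul (continuous_plusMean (lattice d) (h := fun _ => 0)
      (fun t σ _ => energy_doubleBox J t hn σ) (A n))
  have hint : Tendsto
      (fun n => ∫ t in (0 : ℝ)..J, horizontalAverage (coupling d J t) 0 (doubleBox d n) n f)
      atTop (𝓝 (∫ t in (0 : ℝ)..J, L t)) := by
    refine intervalIntegral.tendsto_integral_filter_of_dominated_convergence (fun _ => 1) ?_ ?_ ?_ ?_
    · filter_upwards [eventually_ge_atTop 1] with n hn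
      exact (hcont n hn).aestronglyMeasurable
    · filter_upwards with n
      filter_upwards with t _
      refine abs_horizontalAverage_le _ _ fun σ => ?_
      simp [hf, spinAt, abs_mul, abs_spin]
    · exact intervalIntegrable_const
    · filter_upwards with t ht
      rw [Set.uIoc_of_le hJ] at ht
      exact (hL t ht.1.le).2
  refine ⟨1 / 2 * ∫ t in (0 : ℝ)..J, L t, (hint.const_mul (1 / 2)).congr' ?_⟩
  filter_upwards [eventually_ge_atTop 1] with n hn
  simp only [havg]
  rw [intervalIntegral.integral_const_mul, integral_plusMean (lattice d) (h := fun _ => 0)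
      (fun t σ _ => energy_doubleBox J t hn σ) 0 J, surfaceEnergySeq_one,
      gibbsSum_doubleBox_decoupled, Real.log_pow]
  have hN := card_horizontalBox_pos d n
  field_simp
  push_cast
  ring

end ZeroField

/-! ### Dependence of the surface energy on the field -/

section Field

variable {d : ℕ} {δ J : ℝ}

/-- The limit of the horizontal averages is the plus magnetization on the axis. The sign of `s` is
free, as the minus state needs. -/
theorem averageTendsto_limitState (hJ : 0 ≤ J) (δ s : ℝ) (l : ℕ) :
    AverageTendsto (coupling d J 0) (decayingField d δ s) (box d) (spinAt (axisSite d l))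
      (limitState d J (decayingField d δ s) 1 (spinAt (axisSite d l))) := by
  obtain ⟨L, hL⟩ := exists_averageTendsto_spinAt (h := decayingField d δ s)
    (coupling_nonneg (d := d) hJ le_rfl) (coupling_shift J 0) (fun _ _ => rfl) shift_mem_box
    (axisSite d l)
  have h1 : limitState d J (decayingField d δ s) 1 (spinAt (axisSite d l)) = L := by
    refine Tendsto.limUnder_eq ?_
    simp only [boxState_one]
    exact hL.1
  rwa [h1]

theorem abs_limitState_le (hJ : 0 ≤ J) (δ s : ℝ) (l : ℕ) :
    |limitState d J (decayingField d δ s) 1 (spinAt (axisSite d l))| ≤ 1 :=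
  le_of_tendsto (averageTendsto_limitState hJ δ s l).1.abs (Eventually.of_forall fun _ =>
    abs_plusMean_le _ _ _ _ fun _ => (abs_spin _).le)

/-- The assumption `δ > 1` enters here: these weights dominate the sum over layers, uniformly in `n`
and `s`. -/
theorem summable_wall_weight (hδ : 1 < δ) : Summable fun k : ℕ => 1 / ((k + 1 : ℕ) : ℝ) ^ δ :=
  (summable_nat_add_iff (f := fun k : ℕ => 1 / (k : ℝ) ^ δ) 1).2 (Real.summable_one_div_nat_rpow.2 hδ)

/-- The weighted sum `∑ ℓ^{-δ} ⟨σ_{ℓ e_d}⟩^+` of the magnetization profile. -/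
def wallMagnetization (d : ℕ) (J δ s : ℝ) : ℝ :=
  ∑' k : ℕ, 1 / ((k + 1 : ℕ) : ℝ) ^ δ *
    limitState d J (decayingField d δ s) 1 (spinAt (axisSite d (k + 1)))

theorem abs_weight_mul_le (k : ℕ) (δ : ℝ) {a : ℝ} (ha : |a| ≤ 1) :
    |1 / ((k + 1 : ℕ) : ℝ) ^ δ * a| ≤ 1 / ((k + 1 : ℕ) : ℝ) ^ δ := by
  have h0 : 0 ≤ 1 / ((k + 1 : ℕ) : ℝ) ^ δ := by positivity
  rw [abs_mul, abs_of_nonneg h0]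
  exact mul_le_of_le_one_right h0 ha

theorem summable_wallMagnetization (hJ : 0 ≤ J) (hδ : 1 < δ) (s : ℝ) :
    Summable fun k : ℕ => 1 / ((k + 1 : ℕ) : ℝ) ^ δ *
      limitState d J (decayingField d δ s) 1 (spinAt (axisSite d (k + 1))) :=
  (summable_wall_weight hδ).of_norm_bounded fun k =>
    abs_weight_mul_le k δ (abs_limitState_le hJ δ s (k + 1))

/-- The finite-volume version of `wallMagnetization`. -/
def boxMagnetization (d : ℕ) (J δ : ℝ) (n : ℕ) (s : ℝ) : ℝ :=
  ∑ k ∈ Finset.range n, 1 / ((k + 1 : ℕ) : ℝ) ^ δ *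
    horizontalAverage (coupling d J 0) (decayingField d δ s) (box d n) n (spinAt (axisSite d (k + 1)))

theorem abs_average_spinAt_le (s : ℝ) (n l : ℕ) :
    |horizontalAverage (coupling d J 0) (decayingField d δ s) (box d n) n
      (spinAt (axisSite d l))| ≤ 1 :=
  abs_horizontalAverage_le _ _ fun _ => (abs_spin _).le

theorem tendsto_boxMagnetization (hJ : 0 ≤ J) (hδ : 1 < δ) (s : ℝ) :
    Tendsto (fun n => boxMagnetization d J δ n s) atTop (𝓝 (wallMagnetization d J δ s)) := by
  -- Extending by zero above height `n` makes the index set independent of `n`, so that dominated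
  -- convergence for series applies.
  have h1 (n : ℕ) : boxMagnetization d J δ n s = ∑' k : ℕ, if k ∈ Finset.range n then
      1 / ((k + 1 : ℕ) : ℝ) ^ δ * horizontalAverage (coupling d J 0) (decayingField d δ s)
        (box d n) n (spinAt (axisSite d (k + 1))) else 0 := by
    rw [tsum_eq_sum (s := Finset.range n) fun k hk => if_neg hk, ← Finset.sum_filter,
      Finset.filter_mem_eq_inter, Finset.inter_self]
    rfl
  simp only [h1]
  refine tendsto_tsum_of_dominated_convergence (summable_wall_weight hδ) (fun k => ?_) ?_
  · refine ((averageTendsto_limitState hJ δ s (k + 1)).2.const_mul _).congr' ?_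
    filter_upwards [eventually_gt_atTop k] with n hn
    rw [if_pos (Finset.mem_range.2 hn)]
  · filter_upwards with n k
    split_ifs
    · exact abs_weight_mul_le k δ (abs_average_spinAt_le ..)
    · rw [norm_zero]
      positivity

theorem abs_boxMagnetization_le (hδ : 1 < δ) (n : ℕ) (s : ℝ) :
    |boxMagnetization d J δ n s| ≤ ∑' k : ℕ, 1 / ((k + 1 : ℕ) : ℝ) ^ δ :=
  (Finset.abs_sum_le_sum_abs _ _).trans <|
    (Finset.sum_le_sum fun k _ => abs_weight_mul_le k δ (abs_average_spinAt_le ..)).trans <|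
      (summable_wall_weight hδ).sum_le_tsum _ fun k _ => by positivity

theorem boxMagnetization_eq (d : ℕ) (J δ : ℝ) (n : ℕ) (s : ℝ) :
    boxMagnetization d J δ n s = 1 / ((horizontalBox d n).card : ℝ) *
      plusMean (lattice d) (coupling d J 0) (decayingField d δ s) (box d n) fun σ =>
        ∑ k ∈ Finset.range n, ∑ x ∈ horizontalBox d n,
          1 / ((k + 1 : ℕ) : ℝ) ^ δ * spin (σ (x, ((k + 1 : ℕ) : ℤ))) := by
  rw [boxMagnetization, plusMean_sum, Finset.mul_sum]
  refine Finset.sum_congr rfl fun k _ => ?_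
  rw [plusMean_sum, horizontalAverage, mul_left_comm, Finset.mul_sum]
  refine congrArg _ (Finset.sum_congr rfl fun x _ => ?_)
  rw [← plusMean_smul]
  refine congrArg _ (funext fun σ => ?_)
  simp [spinAt, axisSite]

theorem continuous_boxMagnetization (d : ℕ) (J δ : ℝ) (n : ℕ) :
    Continuous (boxMagnetization d J δ n) := by
  rw [funext (boxMagnetization_eq d J δ n)]
  exact continuous_const.mul (continuous_plusMean (lattice d) (K := fun _ => coupling d J 0)
    (fun s σ _ => energy_decayingField _ δ s n σ) _)

theorem intervalIntegrable_wallMagnetization (hJ : 0 ≤ J) (hδ : 1 < δ) (a b : ℝ) :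
    IntervalIntegrable (wallMagnetization d J δ) volume a b := by
  -- Measurability in `s` comes from being a pointwise limit of continuous finite-volume functions;
  -- continuity of the limit is not needed.
  have hmeas : Measurable (wallMagnetization d J δ) :=
    measurable_of_tendsto_metrizable (fun n => (continuous_boxMagnetization d J δ n).measurable)
      (tendsto_pi_nhds.2 (tendsto_boxMagnetization hJ hδ))
  refine (intervalIntegrable_const (c := ∑' k : ℕ, 1 / ((k + 1 : ℕ) : ℝ) ^ δ)).mono_fun
    hmeas.aestronglyMeasurable ?_
  filter_upwards with s
  exact (le_of_tendsto (tendsto_boxMagnetization hJ hδ s).abs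
    (Eventually.of_forall fun n => abs_boxMagnetization_le hδ n s)).trans (le_abs_self _)

theorem tendsto_integral_boxMagnetization (hJ : 0 ≤ J) (hδ : 1 < δ) (a b : ℝ) :
    Tendsto (fun n => ∫ s in a..b, boxMagnetization d J δ n s) atTop
      (𝓝 (∫ s in a..b, wallMagnetization d J δ s)) := by
  refine intervalIntegral.tendsto_integral_filter_of_dominated_convergence
    (fun _ => ∑' k : ℕ, 1 / ((k + 1 : ℕ) : ℝ) ^ δ) ?_ ?_ intervalIntegrable_const ?_
  · filter_upwards with n
    exact (continuous_boxMagnetization d J δ n).aestronglyMeasurable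
  · filter_upwards with n
    filter_upwards with s _
    exact abs_boxMagnetization_le hδ n s
  · filter_upwards with s _
    exact tendsto_boxMagnetization hJ hδ s

theorem decayingField_zero (d : ℕ) (δ : ℝ) : decayingField d δ 0 = 0 := by
  funext i
  simp [decayingField]

theorem neg_decayingField (d : ℕ) (δ s : ℝ) : -decayingField d δ s = decayingField d δ (-s) := by
  funext i
  simp [decayingField, neg_div]

/-- The denominator does not depend on the field, so only the logarithm of `Z_n` changes; the square
cancels the `2` in the normalization. -/
theorem surfaceEnergySeq_decayingField (d : ℕ) (J δ lam : ℝ) (n : ℕ) :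
    surfaceEnergySeq d J (decayingField d δ lam) 1 n =
      surfaceEnergySeq d J 0 1 n - ∫ s in (0 : ℝ)..lam, boxMagnetization d J δ n s := by
  simp only [boxMagnetization_eq]
  rw [intervalIntegral.integral_const_mul, integral_plusMean (lattice d)
    (K := fun _ => coupling d J 0) (fun s σ _ => energy_decayingField _ δ s n σ) 0 lam,
    surfaceEnergySeq_one, surfaceEnergySeq_one, decayingField_zero]
  have hN := card_horizontalBox_pos d n
  field_simp
  ring

theorem surfaceEnergySeq_neg_one (d : ℕ) (J : ℝ) (h : Site d → ℝ) :
    surfaceEnergySeq d J h (-1) = surfaceEnergySeq d J (-h) 1 := by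
  funext n
  rw [surfaceEnergySeq, surfaceEnergySeq, boxPartition_neg_one, doubleBoxPartition_neg_one]

/-- One zero-field constant `F` serves every real `lam`, so it cancels between the fields `lam` and
`-lam`. -/
theorem exists_tendsto_surfaceEnergySeq (d : ℕ) (hJ : 0 ≤ J) (hδ : 1 < δ) :
    ∃ F, ∀ lam, Tendsto (surfaceEnergySeq d J (decayingField d δ lam) 1) atTop
      (𝓝 (F - ∫ s in (0 : ℝ)..lam, wallMagnetization d J δ s)) := by
  obtain ⟨F, hF⟩ := tendsto_surfaceEnergySeq_zero (d := d) hJ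
  exact ⟨F, fun lam => (hF.sub (tendsto_integral_boxMagnetization hJ hδ 0 lam)).congr fun n =>
    (surfaceEnergySeq_decayingField d J δ lam n).symm⟩

theorem tendsto_boxState (hJ : 0 ≤ J) (δ s : ℝ) (l : ℕ) :
    Tendsto (fun n => boxState d J (decayingField d δ s) 1 n (spinAt (axisSite d l))) atTop
      (𝓝 (limitState d J (decayingField d δ s) 1 (spinAt (axisSite d l)))) := by
  simp only [boxState_one]
  exact (averageTendsto_limitState hJ δ s l).1

theorem tendsto_boxState_neg_one (hJ : 0 ≤ J) (δ s : ℝ) (l : ℕ) :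
    Tendsto (fun n => boxState d J (decayingField d δ s) (-1) n (spinAt (axisSite d l))) atTop
      (𝓝 (-limitState d J (decayingField d δ (-s)) 1 (spinAt (axisSite d l)))) := by
  refine (tendsto_boxState hJ δ (-s) l).neg.congr fun n => ?_
  rw [boxState_neg_one, neg_decayingField, boxState_one, boxState_one, neg_eq_neg_one_mul,
    ← plusMean_smul]
  refine congrArg _ (funext fun σ => ?_)
  simp [spinAt]

theorem limitState_neg_one (hJ : 0 ≤ J) (δ s : ℝ) (l : ℕ) :
    limitState d J (decayingField d δ s) (-1) (spinAt (axisSite d l)) =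
      -limitState d J (decayingField d δ (-s)) 1 (spinAt (axisSite d l)) :=
  (tendsto_boxState_neg_one hJ δ s l).limUnder_eq

/-- By spin flip the minus magnetization at `s` is the negative of the plus magnetization at `-s`,
so the gap becomes a sum of two plus profiles. -/
theorem hasSum_magnetizationGap (hJ : 0 ≤ J) (hδ : 1 < δ) (s : ℝ) :
    HasSum (fun k : ℕ => magnetizationGap d J δ s (k + 1))
      (wallMagnetization d J δ s + wallMagnetization d J δ (-s)) := by
  have h : HasSum _ (wallMagnetization d J δ s + wallMagnetization d J δ (-s)) :=
    (summable_wallMagnetization (d := d) hJ hδ s).hasSum.add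
    (summable_wallMagnetization (d := d) hJ hδ (-s)).hasSum
  convert h using 1
  funext k
  rw [magnetizationGap, limitState_neg_one hJ]
  ring

end Field

end

end SemiInfiniteIsing

theorem mainTheorem5 (d : ℕ) (hd : 1 ≤ d) (δ : ℝ) (hδ : 1 < δ) (J : ℝ) (hJ : 0 < J)
    (lam : ℝ) (hlam : 0 ≤ lam) :
    -- the limits that define the two free surface energies exist
    (∀ ε : ℤˣ, Tendsto (surfaceEnergySeq d J (decayingField d δ lam) ε) atTop
      (𝓝 (surfaceEnergy d J (decayingField d δ lam) ε))) ∧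
    -- the limits that define the infinite-volume magnetizations exist
    (∀ s : ℝ, 0 ≤ s → ∀ ε : ℤˣ, ∀ ℓ : ℕ, 1 ≤ ℓ →
      Tendsto (fun n => boxState d J (decayingField d δ s) ε n (spinAt (axisSite d ℓ))) atTop
        (𝓝 (limitState d J (decayingField d δ s) ε (spinAt (axisSite d ℓ))))) ∧
    -- the series over `ℓ ≥ 1` converges and its sum is integrable over `[0, lam]`
    (∀ s : ℝ, 0 ≤ s → Summable fun k : ℕ => magnetizationGap d J δ s (k + 1)) ∧
    IntervalIntegrable (fun s => ∑' k : ℕ, magnetizationGap d J δ s (k + 1)) volume 0 lam ∧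
    wallFreeEnergy d J (decayingField d δ lam) =
      ∫ s in (0 : ℝ)..lam, ∑' k : ℕ, magnetizationGap d J δ s (k + 1) := by
  obtain ⟨F, hF⟩ := exists_tendsto_surfaceEnergySeq d hJ.le hδ
  have hF' : Tendsto (surfaceEnergySeq d J (decayingField d δ lam) (-1)) atTop
      (𝓝 (F - ∫ s in (0 : ℝ)..(-lam), wallMagnetization d J δ s)) := by
    rw [surfaceEnergySeq_neg_one, neg_decayingField]
    exact hF (-lam)
  have hp : surfaceEnergy d J (decayingField d δ lam) 1 = _ := (hF lam).limUnder_eq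
  have hm : surfaceEnergy d J (decayingField d δ lam) (-1) = _ := hF'.limUnder_eq
  have hsum (s : ℝ) := hasSum_magnetizationGap (d := d) hJ.le hδ s
  have hint := intervalIntegrable_wallMagnetization (d := d) hJ.le hδ
  have hint' : IntervalIntegrable (fun s => wallMagnetization d J δ (-s)) volume 0 lam := by
    simpa using (IntervalIntegrable.iff_comp_neg).1 (hint 0 (-lam))
  refine ⟨fun ε => ?_, fun s _ ε ℓ _ => ?_, fun s _ => (hsum s).summable, ?_, ?_⟩
  · rcases Int.units_eq_one_or ε with rfl | rfl
    · rw [hp]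
      exact hF lam
    · rw [hm]
      exact hF'
  · rcases Int.units_eq_one_or ε with rfl | rfl
    · exact tendsto_boxState hJ.le δ s ℓ
    · rw [limitState_neg_one hJ.le]
      exact tendsto_boxState_neg_one hJ.le δ s ℓ
  · simp only [fun s => (hsum s).tsum_eq]
    exact (hint 0 lam).add hint'
  · simp only [fun s => (hsum s).tsum_eq]
    -- The substitution `s ↦ -s` turns the second summand into the integral over `[-lam, 0]`, which
    -- is the minus surface energy measured from `F`.
    rw [intervalIntegral.integral_add (hint 0 lam) hint',
      intervalIntegral.integral_comp_neg (wallMagnetization d J δ), wallFreeEnergy, hp, hm,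
      neg_zero, intervalIntegral.integral_symm (-lam) 0]
    ring
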